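/- **Setting (Polarized SILL).** Session types are positive or negative; they are built from $\mathbf 1$, variables $\alpha$, recursive types $\rho\alpha.A$, shifts ${\downarrow}A,{\uparrow}A$, choices $\oplus\{l:A_l\}_{l\in L}$, $\&\{l:A_l\}_{l\in L}$ ($L$ finite), channel transmission $B\otimes A$ and $B\multimap A$, and value transmission $\tau\wedge A$ and $\tau\supset A$, where $\tau$ is a functional type (a function type $\tau\to\sigma$ or a type $\{a:A\leftarrow a_1:A_1,\dots,a_n:A_n\}$ of quoted processes). A well-typed process, $\Psi;\Delta\vdash P::c:C$, provides a channel $c$ of closed session type $C$ and uses the channels declared in $\Delta$ (distinct from each other and from $c$); $\Psi$ declares functional variables. The rules for such judgments are the usual ones: forwarding, cut, left and right rules for each session type, and execution of a quoted process; functional terms are variables, $\lambda$-abstractions, applications, $\mathsf{fix}$, and quoted processes. In particular: * (Cut) if $\Psi;\Delta_1\vdash P::a:A$ and $\Psi;a:A,\Delta_2\vdash Q::c:C$, then $\Psi;\Delta_1,\Delta_2\vdash (a\leftarrow P;Q)::c:C$; * ($\otimes R^*$) if $\Psi;\Delta\vdash P::a:A$, then $\Psi;\Delta,b:B\vdash(\mathsf{send}\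 a\ b;P)::a:B\otimes A$; * ($\otimes L$) if $\Psi;\Delta,a:A,b:B\vdash Q::c:C$, then $\Psi;\Delta,a:B\otimes A\vdash(b\leftarrow\mathsf{recv}\ a;Q)::c:C$. **Denotations.** Domains are pointed dcpos. Each closed session type $A$ denotes two domains, a negative aspect $[\![A]\!]^-$ and a positive aspect $[\![A]\!]^+$; for instance $[\![B\otimes A]\!]^-=[\![B]\!]^-\times[\![A]\!]^-$ and $[\![B\otimes A]\!]^+=([\![B]\!]^+\times[\![A]\!]^+)_\bot$, where $D_\bot$ is the lifting of $D$, and recursive types denote canonical (bilimit) fixed points. Contexts denote products: $[\![\Psi]\!]=\prod_{x:\tau\in\Psi}[\![\tau]\!]$ and $[\![\Delta]\!]^{\pm}=\prod_{a:A\in\Delta}[\![A]\!]^{\pm}$. By recursion on its typing derivation, a process $\Psi;\Delta\vdash P::c:C$ denotes a continuous function $$[\![P]\!]\colon[\![\Psi]\!]\to\bigl[\,[\![\Delta]\!]^+\times[\![C]\!]^-\to[\![\Delta]\!]^-\times[\![C]\!]^+\,\bigr].$$ For the three rules above and $u\in[\![\Psi]\!]$ the clauses are as follows. * $[\![a\leftarrow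 P;Q]\!]u=\mathrm{Tr}^{a^-\times a^+}\bigl([\![P]\!]u\times[\![Q]\!]u\bigr)$, where the trace of a continuous $f\colon X\times U\to Y\times U$ is $\mathrm{Tr}^U(f)(x)=\pi_Y f(x,w)$ with $w$ the least fixed point of $w\mapsto\pi_U f(x,w)$. So both aspects of the channel $a$ are fed back. * $[\![\mathsf{send}\ a\ b;P]\!]u\,(\delta^+,b^+,(a_B^-,a_A^-))=(\delta^-,a_B^-,\lfloor(b^+,a_A^+)\rfloor)$, where $[\![P]\!]u(\delta^+,a_A^-)=(\delta^-,a_A^+)$, $a_B^-$ is the output on $b$, and $\lfloor\cdot\rfloor$ is the inclusion into the lifting. * $[\![b\leftarrow\mathsf{recv}\ a;Q]\!]u\,(\delta^+,a^+,c^-)$ is $\bot$ if $a^+=\bot$; if $a^+=\lfloor(a_B^+,a_A^+)\rfloor$, it is $(\delta^-,(b^-,a^-),c^+)$, where $[\![Q]\!]u(\delta^+,a_A^+,a_B^+,c^-)=(\delta^-,a^-,b^-,c^+)$ (the arguments on $\Delta$, $a$, $b$, $c$, and likewise the results). Processes $P$ and $Q$ of the same judgment are denotationally equal, $P\equiv Q$,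 if $[\![P]\!]=[\![Q]\!]$. **Proposition ($\eta$ for $\otimes$).** Let $A$ and $B$ be closed positive session types. If $\Psi;\Delta_1\vdash P::a:A$ and $\Psi;a:A,\Delta_2,b:B\vdash Q::c:C$, where the names in $\Delta_1,\Delta_2,b,c$ are distinct, then $$\Psi;\Delta_1,\Delta_2,b:B\;\vdash\;\bigl(a\leftarrow P;\,Q\bigr)\;\equiv\;\bigl(a\leftarrow(\mathsf{send}\ a\ b;P);\,(b\leftarrow\mathsf{recv}\ a;Q)\bigr)\;::\;c:C,$$ where the cut on the right is over the channel $a:B\otimes A$. -/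

import Mathlib

namespace SILL

/-! ## Pointed dcpos and Scott-continuous functions -/

/-- Every nonempty directed subset of `α` has a least upper bound. -/
def DirectedComplete (α : Type) [PartialOrder α] : Prop :=
  ∀ s : Set α, s.Nonempty → DirectedOn (· ≤ ·) s → ∃ x, IsLUB s x

/-- A domain: a pointed directed-complete partial order. -/
structure Dom : Type 1 where
  carrier : Type
  [order : PartialOrder carrier]
  [orderBot : OrderBot carrier]
  dc : DirectedComplete carrier

instance : CoeSort Dom Type := ⟨Dom.carrier⟩
instance (D : Dom) : PartialOrder D := D.order
instance (D : Dom) : OrderBot D := D.orderBot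

/-- The least upper bound of a set that has one (and `⊥` otherwise). -/
noncomputable def Dom.lub (D : Dom) (s : Set D) : D :=
  open Classical in if h : ∃ x, IsLUB s x then h.choose else ⊥

theorem Dom.isLUB_lub (D : Dom) {s : Set D} (h1 : s.Nonempty) (h2 : DirectedOn (· ≤ ·) s) :
    IsLUB s (D.lub s) := by
  have h := D.dc s h1 h2
  rw [Dom.lub, dif_pos h]
  exact h.choose_spec

/-- Scott-continuous functions. -/
structure Hom (α β : Type) [PartialOrder α] [PartialOrder β] where
  toFun : α → β
  cont : ScottContinuous toFun

infixr:25 " ⟶c " => Hom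

section Hom
variable {α β γ : Type} [PartialOrder α] [PartialOrder β] [PartialOrder γ]

instance : CoeFun (α ⟶c β) (fun _ => α → β) := ⟨Hom.toFun⟩

@[ext] theorem Hom.ext {f g : α ⟶c β} (h : ∀ x, f x = g x) : f = g := by
  cases f; cases g; congr; exact funext h

instance : PartialOrder (α ⟶c β) where
  le f g := ∀ x, f x ≤ g x
  le_refl _ _ := le_rfl
  le_trans _ _ _ h1 h2 x := (h1 x).trans (h2 x)
  le_antisymm _ _ h1 h2 := Hom.ext fun x => (h1 x).antisymm (h2 x)

theorem Hom.mono (f : α ⟶c β) : Monotone f := f.cont.monotone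

@[fun_prop] theorem Hom.cont' (f : α ⟶c β) : ScottContinuous (fun x => f x) := f.cont

/-- A pointwise least upper bound of continuous functions is continuous. -/
theorem scottContinuous_of_isLUB {S : Set (α ⟶c β)} {g : α → β}
    (hg : ∀ x, IsLUB ((fun f : α ⟶c β => f x) '' S) (g x)) : ScottContinuous g := by
  intro d hd hd' a ha
  constructor
  · rintro _ ⟨x, hx, rfl⟩
    refine (hg x).2 ?_
    rintro _ ⟨f, hf, rfl⟩
    exact (f.mono (ha.1 hx)).trans ((hg a).1 ⟨f, hf, rfl⟩)
  · intro b hb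
    refine (hg a).2 ?_
    rintro _ ⟨f, hf, rfl⟩
    refine (f.cont hd hd' ha).2 ?_
    rintro _ ⟨x, hx, rfl⟩
    exact ((hg x).1 ⟨f, hf, rfl⟩).trans (hb ⟨x, hx, rfl⟩)

theorem isLUB_hom {S : Set (α ⟶c β)} {g : α ⟶c β}
    (hg : ∀ x, IsLUB ((fun f : α ⟶c β => f x) '' S) (g x)) : IsLUB S g := by
  constructor
  · intro f hf x
    exact (hg x).1 ⟨f, hf, rfl⟩
  · intro b hb x
    refine (hg x).2 ?_
    rintro _ ⟨f, hf, rfl⟩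
    exact hb hf x

theorem directedOn_eval {S : Set (α ⟶c β)} (h : DirectedOn (· ≤ ·) S) (x : α) :
    DirectedOn (· ≤ ·) ((fun f : α ⟶c β => f x) '' S) := by
  rintro _ ⟨f, hf, rfl⟩ _ ⟨g, hg, rfl⟩
  obtain ⟨k, hk, h1, h2⟩ := h f hf g hg
  exact ⟨_, ⟨k, hk, rfl⟩, h1 x, h2 x⟩

theorem Hom.exists_isLUB (hβ : DirectedComplete β) {S : Set (α ⟶c β)} (h1 : S.Nonempty)
    (h2 : DirectedOn (· ≤ ·) S) :
    ∃ g : α ⟶c β, ∀ x, IsLUB ((fun f : α ⟶c β => f x) '' S) (g x) := by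
  choose g hg using fun x => hβ _ (h1.image _) (directedOn_eval h2 x)
  exact ⟨⟨g, scottContinuous_of_isLUB hg⟩, hg⟩

theorem Hom.isLUB_eval (hβ : DirectedComplete β) {S : Set (α ⟶c β)} (h1 : S.Nonempty)
    (h2 : DirectedOn (· ≤ ·) S) {g : α ⟶c β} (hg : IsLUB S g) (x : α) :
    IsLUB ((fun f : α ⟶c β => f x) '' S) (g x) := by
  obtain ⟨g', hg'⟩ := Hom.exists_isLUB hβ h1 h2
  rw [hg.unique (isLUB_hom hg')]
  exact hg' x

end Hom

/-- The one-point domain. -/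
def Dom.one : Dom where
  carrier := PUnit
  dc := fun _ _ _ => ⟨⊥, fun _ _ => le_rfl, fun _ _ => le_rfl⟩

/-- Binary products. -/
def Dom.prod (D E : Dom) : Dom where
  carrier := D × E
  dc := by
    intro s h1 h2
    obtain ⟨x, hx⟩ := D.dc _ (h1.image Prod.fst) h2.fst
    obtain ⟨y, hy⟩ := E.dc _ (h1.image Prod.snd) h2.snd
    exact ⟨(x, y), isLUB_prod.2 ⟨hx, hy⟩⟩

/-- Indexed products. -/
def Dom.pi {I : Type} (D : I → Dom) : Dom where
  carrier := ∀ i, D i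
  dc := by
    intro s h1 h2
    choose x hx using fun i => (D i).dc ((fun f : ∀ i, D i => f i) '' s) (h1.image _) (by
      rintro _ ⟨f, hf, rfl⟩ _ ⟨g, hg, rfl⟩
      obtain ⟨k, hk, h1, h2⟩ := h2 f hf g hg
      exact ⟨_, ⟨k, hk, rfl⟩, h1 i, h2 i⟩)
    exact ⟨x, isLUB_pi.2 hx⟩

/-- The domain of continuous functions, ordered pointwise. -/
def Dom.fn (D E : Dom) : Dom where
  carrier := D ⟶c E
  orderBot := { bot := ⟨fun _ => ⊥, ScottContinuous.fun_const _⟩, bot_le := fun _ _ => bot_le }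
  dc := fun _ h1 h2 => (Hom.exists_isLUB E.dc h1 h2).imp fun _ h => isLUB_hom h

/-- The domain of strict continuous functions, ordered pointwise. -/
def Dom.strictFn (D E : Dom) : Dom where
  carrier := {f : D ⟶c E // f ⊥ = ⊥}
  orderBot :=
    { bot := ⟨⟨fun _ => ⊥, ScottContinuous.fun_const _⟩, rfl⟩
      bot_le := fun _ _ => bot_le }
  dc := by
    intro s h1 h2
    have h3 : DirectedOn (· ≤ ·) (Subtype.val '' s) := by
      rintro _ ⟨f, hf, rfl⟩ _ ⟨g, hg, rfl⟩
      obtain ⟨k, hk, h1, h2⟩ := h2 f hf g hg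
      exact ⟨_, ⟨k, hk, rfl⟩, h1, h2⟩
    obtain ⟨g, hg⟩ := Hom.exists_isLUB E.dc (h1.image Subtype.val) h3
    have hb : g ⊥ = ⊥ := by
      refine le_antisymm ((hg ⊥).2 ?_) bot_le
      rintro _ ⟨_, ⟨f, _, rfl⟩, rfl⟩
      exact f.2.le
    refine ⟨⟨g, hb⟩, fun f hf => (isLUB_hom hg).1 ⟨f, hf, rfl⟩, fun k hk => ?_⟩
    refine (isLUB_hom hg).2 ?_
    rintro _ ⟨f, hf, rfl⟩
    exact hk hf

theorem directedComplete_withBot {α : Type} [PartialOrder α] (h : DirectedComplete α) :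
    DirectedComplete (WithBot α) := by
  intro s h1 h2
  by_cases hs : ∃ a : α, (a : WithBot α) ∈ s
  · obtain ⟨x, hx⟩ := h {a | (a : WithBot α) ∈ s} hs (by
      intro a ha b hb
      obtain ⟨c, hc, h3, h4⟩ := h2 _ ha _ hb
      induction c with
      | bot => simp at h3
      | coe c => exact ⟨c, hc, WithBot.coe_le_coe.1 h3, WithBot.coe_le_coe.1 h4⟩)
    refine ⟨x, fun y hy => ?_, fun y hy => ?_⟩
    · induction y with
      | bot => exact bot_le
      | coe y => exact WithBot.coe_le_coe.2 (hx.1 hy)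
    · induction y with
      | bot => obtain ⟨a, ha⟩ := hs; simpa using hy ha
      | coe y => exact WithBot.coe_le_coe.2 (hx.2 fun a ha => WithBot.coe_le_coe.1 (hy ha))
  · refine ⟨⊥, fun y hy => ?_, fun y _ => bot_le⟩
    induction y with
    | bot => exact bot_le
    | coe y => exact absurd ⟨y, hy⟩ hs

/-- The lifting `D_⊥`: a new bottom element is adjoined; `(d : WithBot D)` is the image of `d`. -/
def Dom.lift (D : Dom) : Dom where
  carrier := WithBot D
  dc := directedComplete_withBot D.dc

theorem directedComplete_sigma {L : Type} {D : L → Dom} : DirectedComplete (Σ l, D l) := by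
  rintro s ⟨⟨l, x⟩, hx⟩ h2
  have key : ∀ y ∈ s, y.1 = l := by
    intro y hy
    obtain ⟨z, _, h3, h4⟩ := h2 _ hx _ hy
    obtain ⟨_, _, _⟩ := h3
    cases h4
    rfl
  obtain ⟨z, hz⟩ := (D l).dc {a | (⟨l, a⟩ : Σ l, D l) ∈ s} ⟨x, hx⟩ (by
    intro a ha b hb
    obtain ⟨⟨k, c⟩, hc, h3, h4⟩ := h2 _ ha _ hb
    obtain rfl : k = l := key _ hc
    exact ⟨c, hc, Sigma.mk_le_mk_iff (α := fun l => (D l).carrier) |>.1 h3, Sigma.mk_le_mk_iff (α := fun l => (D l).carrier) |>.1 h4⟩)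
  refine ⟨⟨l, z⟩, ?_, ?_⟩
  · rintro ⟨k, y⟩ hy
    obtain rfl : k = l := key _ hy
    exact Sigma.mk_le_mk_iff.2 (hz.1 hy)
  · rintro ⟨k, y⟩ hy
    obtain rfl : l = k := by
      have := hy hx
      cases this
      rfl
    exact Sigma.mk_le_mk_iff.2 (hz.2 fun a ha => Sigma.mk_le_mk_iff (α := fun l => (D l).carrier) |>.1 (hy ha))

/-- The coalesced sum `⨁ₗ (Dₗ)_⊥` of liftings.  Its elements are `⊥` and the tagged elements
`(k, ↑d)` with `d ∈ Dₖ`; elements with different tags are incomparable. -/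
def Dom.sum {L : Type} (D : L → Dom) : Dom where
  carrier := WithBot (Σ l, D l)
  dc := directedComplete_withBot directedComplete_sigma

/-! ## Operations on domains and their continuity -/

section Continuity
variable {X Y Z : Type} [PartialOrder X] [PartialOrder Y] [PartialOrder Z]

theorem directedOn_image {f : X → Y} (hf : Monotone f) {d : Set X} (h : DirectedOn (· ≤ ·) d) :
    DirectedOn (· ≤ ·) (f '' d) := by
  rintro _ ⟨x, hx, rfl⟩ _ ⟨y, hy, rfl⟩
  obtain ⟨z, hz, h1, h2⟩ := h x hx y hy
  exact ⟨_, ⟨z, hz, rfl⟩, hf h1, hf h2⟩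

@[fun_prop] theorem cont_apply {I : Type} {D : I → Dom} (i : I) :
    ScottContinuous (fun x : ∀ i, D i => x i) := by
  intro d _ _ a ha
  exact isLUB_pi.1 ha i

@[fun_prop] theorem cont_pi {I : Type} {D : I → Dom} {f : X → ∀ i, D i}
    (hf : ∀ i, ScottContinuous fun x => f x i) : ScottContinuous f := by
  intro d h1 h2 a ha
  refine isLUB_pi.2 fun i => ?_
  rw [Set.image_image]
  exact hf i h1 h2 ha

/-- Abstraction: `x ↦ (y ↦ f x y)`, for jointly continuous `f`. -/
def lam (f : X → Y → Z) (hf : ∀ x, ScottContinuous (f x)) (x : X) : Y ⟶c Z := ⟨f x, hf x⟩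

theorem cont_lam {f : X → Y → Z} (h : ScottContinuous fun p : X × Y => f p.1 p.2)
    (hf : ∀ x, ScottContinuous (f x)) : ScottContinuous (lam f hf) := by
  intro d h1 h2 a ha
  refine isLUB_hom fun y => ?_
  rw [Set.image_image]
  have : ScottContinuous fun x => f x y :=
    ScottContinuous.fun_comp (g := fun p : X × Y => f p.1 p.2) (f := fun x => (x, y))
      (by fun_prop) h
  exact this h1 h2 ha

@[fun_prop] theorem cont_eval {D E : Dom} {f : X → (D ⟶c E)} {g : X → D}
    (hf : ScottContinuous f) (hg : ScottContinuous g) : ScottContinuous fun x => f x (g x) := by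
  have h : ScottContinuous fun p : (D ⟶c E) × D => p.1 p.2 := by
    refine ScottContinuous.fromProd (fun f => f.cont) fun y d h1 h2 a ha => ?_
    exact Hom.isLUB_eval E.dc h1 h2 ha y
  exact ScottContinuous.fun_comp (f := fun x => (f x, g x)) (by fun_prop) h

@[fun_prop] theorem cont_coe {f : X → Y} (hf : ScottContinuous f) :
    ScottContinuous fun x => (f x : WithBot Y) := by
  intro d h1 h2 a ha
  have h := hf h1 h2 ha
  refine ⟨?_, fun y hy => ?_⟩
  · rintro _ ⟨x, hx, rfl⟩
    exact WithBot.coe_le_coe.2 (h.1 ⟨x, hx, rfl⟩)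
  · induction y with
    | bot => obtain ⟨x, hx⟩ := h1; simpa using hy ⟨x, hx, rfl⟩
    | coe y =>
      refine WithBot.coe_le_coe.2 (h.2 ?_)
      rintro _ ⟨x, hx, rfl⟩
      exact WithBot.coe_le_coe.1 (hy ⟨x, hx, rfl⟩)

/-- Strict pattern matching on a lifted argument: `⊥ ↦ ⊥` and `↑y ↦ f y`. -/
def liftElim {E : Dom} (f : Y → E) : WithBot Y → E
  | none => ⊥
  | some y => f y

theorem cont_liftElim {E : Dom} {f : X → Y → E} {g : X → WithBot Y}
    (hf : ScottContinuous fun p : X × Y => f p.1 p.2) (hg : ScottContinuous g) :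
    ScottContinuous fun x => liftElim (f x) (g x) := by
  have h1 : ∀ x, ScottContinuous (f x) := fun x =>
    ScottContinuous.fun_comp (g := fun p : X × Y => f p.1 p.2) (f := fun y => (x, y))
      (by fun_prop) hf
  have h2 : ∀ y, ScottContinuous fun x => f x y := fun y =>
    ScottContinuous.fun_comp (g := fun p : X × Y => f p.1 p.2) (f := fun x => (x, y))
      (by fun_prop) hf
  have h : ScottContinuous fun p : X × WithBot Y => liftElim (f p.1) p.2 := by
    refine ScottContinuous.fromProd (fun x d hd hd' a ha => ?_) (fun y => ?_)
    · constructor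
      · rintro _ ⟨y, hy, rfl⟩
        have hya := ha.1 hy
        induction y with
        | bot => exact bot_le
        | coe y =>
          induction a with
          | bot => simp at hya
          | coe a => exact (h1 x).monotone (WithBot.coe_le_coe.1 hya)
      · intro b hb
        induction a with
        | bot => exact bot_le
        | coe a =>
          have hs : ∃ y : Y, (y : WithBot Y) ∈ d := by
            by_contra hn
            have : (a : WithBot Y) ≤ ⊥ := ha.2 fun y hy => by
              induction y with
              | bot => exact le_rfl
              | coe y => exact absurd ⟨y, hy⟩ hn
            simp at this
          have h3 : DirectedOn (· ≤ ·) {y : Y | (y : WithBot Y) ∈ d} := by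
            intro u hu v hv
            obtain ⟨c, hc, h3, h4⟩ := hd' _ hu _ hv
            induction c with
            | bot => simp at h3
            | coe c => exact ⟨c, hc, WithBot.coe_le_coe.1 h3, WithBot.coe_le_coe.1 h4⟩
          have h4 : IsLUB {y : Y | (y : WithBot Y) ∈ d} a := by
            refine ⟨fun y hy => WithBot.coe_le_coe.1 (ha.1 hy), fun y hy => ?_⟩
            refine WithBot.coe_le_coe.1 (ha.2 fun z hz => ?_)
            induction z with
            | bot => exact bot_le
            | coe z => exact WithBot.coe_le_coe.2 (hy hz)
          refine (h1 x hs h3 h4).2 ?_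
          rintro _ ⟨y, hy, rfl⟩
          exact hb ⟨_, hy, rfl⟩
    · induction y with
      | bot => exact ScottContinuous.fun_const _
      | coe y => exact h2 y
  exact ScottContinuous.fun_comp (f := fun x => (x, g x)) (by fun_prop) h

/-- The counit `D_⊥ → D`, with `⊥ ↦ ⊥` and `↑d ↦ d`. -/
def down {D : Dom} : D.lift → D := liftElim fun d => d

@[fun_prop] theorem cont_down {D : Dom} : ScottContinuous (down : D.lift → D) :=
  cont_liftElim (X := D.lift) (f := fun _ d => d) (g := fun x => x) (by fun_prop) (by fun_prop)

@[fun_prop] theorem cont_sigmaMk {L : Type} {D : L → Dom} {l : L} {f : X → D l}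
    (hf : ScottContinuous f) : ScottContinuous fun x => (⟨l, f x⟩ : Σ l, D l) := by
  intro d h1 h2 a ha
  have h := hf h1 h2 ha
  constructor
  · rintro _ ⟨x, hx, rfl⟩
    exact Sigma.mk_le_mk_iff (α := fun l => (D l).carrier) |>.2 (h.1 ⟨x, hx, rfl⟩)
  · rintro ⟨k, y⟩ hy
    obtain rfl : l = k := by
      obtain ⟨x, hx⟩ := h1
      cases hy ⟨x, hx, rfl⟩
      rfl
    refine Sigma.mk_le_mk_iff (α := fun l => (D l).carrier) |>.2 (h.2 ?_)
    rintro _ ⟨x, hx, rfl⟩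
    exact Sigma.mk_le_mk_iff (α := fun l => (D l).carrier) |>.1 (hy ⟨x, hx, rfl⟩)

theorem cont_sigma {L : Type} {D : L → Dom} {f : X → (Σ l, D l) → Z}
    (hf : ∀ l, ScottContinuous fun p : X × D l => f p.1 ⟨l, p.2⟩) :
    ScottContinuous fun p : X × (Σ l, D l) => f p.1 p.2 := by
  refine ScottContinuous.fromProd (fun x d h1 h2 a ha => ?_) (fun ⟨l, y⟩ => ?_)
  · obtain ⟨l, a⟩ := a
    have key : ∀ y ∈ d, ∃ b : D l, y = ⟨l, b⟩ := fun y hy => by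
      obtain ⟨k, y⟩ := y
      cases ha.1 hy
      exact ⟨y, rfl⟩
    have hd : d = (fun b => (⟨l, b⟩ : Σ l, D l)) '' {b | (⟨l, b⟩ : Σ l, D l) ∈ d} := by
      ext y
      constructor
      · intro hy
        obtain ⟨b, rfl⟩ := key y hy
        exact ⟨b, hy, rfl⟩
      · rintro ⟨b, hb, rfl⟩
        exact hb
    have hl : ScottContinuous fun y : D l => f x ⟨l, y⟩ :=
      ScottContinuous.fun_comp (g := fun p : X × D l => f p.1 ⟨l, p.2⟩) (f := fun y => (x, y))
        (by fun_prop) (hf l)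
    rw [hd, Set.image_image]
    refine hl ?_ ?_ ?_
    · obtain ⟨y, hy⟩ := h1
      obtain ⟨b, rfl⟩ := key y hy
      exact ⟨b, hy⟩
    · intro u hu v hv
      obtain ⟨c, hc, h3, h4⟩ := h2 _ hu _ hv
      obtain ⟨c, rfl⟩ := key c hc
      exact ⟨c, hc, Sigma.mk_le_mk_iff (α := fun l => (D l).carrier) |>.1 h3,
        Sigma.mk_le_mk_iff (α := fun l => (D l).carrier) |>.1 h4⟩
    · refine ⟨fun b hb => Sigma.mk_le_mk_iff (α := fun l => (D l).carrier) |>.1 (ha.1 hb),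
        fun b hb => ?_⟩
      refine Sigma.mk_le_mk_iff (α := fun l => (D l).carrier) |>.1 (ha.2 fun y hy => ?_)
      obtain ⟨c, rfl⟩ := key y hy
      exact Sigma.mk_le_mk_iff (α := fun l => (D l).carrier) |>.2 (hb hy)
  · exact ScottContinuous.fun_comp (g := fun p : X × D l => f p.1 ⟨l, p.2⟩)
      (f := fun x => (x, y)) (by fun_prop) (hf l)

open Classical in
/-- `y` made strict in `x`: the value is `⊥` if `x = ⊥`, and `y` otherwise. -/
noncomputable def strictIn {D E : Dom} (x : D) (y : E) : E := if x = ⊥ then ⊥ else y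

@[fun_prop] theorem cont_strictIn {D E : Dom} {f : X → D} {g : X → E}
    (hf : ScottContinuous f) (hg : ScottContinuous g) :
    ScottContinuous fun x => strictIn (f x) (g x) := by
  have h : ScottContinuous fun p : D × E => strictIn p.1 p.2 := by
    refine ScottContinuous.fromProd (fun x => ?_) (fun y d h1 h2 a ha => ?_)
    · by_cases hx : x = ⊥
      · simp [strictIn, hx]
      · simp [strictIn, hx]
    · constructor
      · rintro _ ⟨x, hx, rfl⟩
        have hxa := ha.1 hx
        by_cases hx : x = ⊥
        · simp [strictIn, hx]
        · have : a ≠ ⊥ := fun h => hx (le_bot_iff.1 (h ▸ hxa))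
          simp [strictIn, hx, this]
      · intro b hb
        by_cases hab : a = ⊥
        · simp [strictIn, hab]
        · have : ∃ x ∈ d, x ≠ ⊥ := by
            by_contra hn
            push Not at hn
            exact hab (le_bot_iff.1 (ha.2 fun x hx => (hn x hx).le))
          obtain ⟨x, hx, hx'⟩ := this
          have := hb ⟨x, hx, rfl⟩
          simpa [strictIn, hx', hab] using this
  exact ScottContinuous.fun_comp (f := fun x => (f x, g x)) (by fun_prop) h

/-- Reindexing along an equality of domains. -/
def castDom {D E : Dom} (h : D = E) (x : D) : E := h ▸ x

@[fun_prop] theorem cont_castDom {D E : Dom} (h : D = E) : ScottContinuous (castDom h) := by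
  subst h
  exact ScottContinuous.fun_id

/-- The least fixed point of a continuous function, as the least upper bound of its iterates. -/
noncomputable def lfp {D : Dom} (f : D ⟶c D) : D := D.lub (Set.range fun n : ℕ => f^[n] ⊥)

theorem isLUB_lfp {D : Dom} (f : D ⟶c D) : IsLUB (Set.range fun n : ℕ => f^[n] ⊥) (lfp f) := by
  refine D.isLUB_lub (Set.range_nonempty _) ?_
  have hm : Monotone fun n : ℕ => f^[n] ⊥ :=
    monotone_nat_of_le_succ fun n => by
      rw [Function.iterate_succ_apply]
      exact f.mono.iterate n bot_le
  rintro _ ⟨m, rfl⟩ _ ⟨n, rfl⟩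
  exact ⟨_, ⟨max m n, rfl⟩, hm (le_max_left _ _), hm (le_max_right _ _)⟩

@[fun_prop] theorem cont_lfp {D : Dom} {f : X → (D ⟶c D)} (hf : ScottContinuous f) :
    ScottContinuous fun x => lfp (f x) := by
  have hn : ∀ n : ℕ, ScottContinuous fun x => (f x)^[n] ⊥ := by
    intro n
    induction n with
    | zero => exact ScottContinuous.fun_const _
    | succ n ih => simpa only [Function.iterate_succ_apply'] using cont_eval hf ih
  refine scottContinuous_of_isLUB (S := Set.range fun n : ℕ => (⟨_, hn n⟩ : X ⟶c D)) fun x => ?_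
  have := isLUB_lfp (f x)
  rwa [← Set.range_comp]

end Continuity

/-- The trace `Tr^U(f) : A → B` of `f : A × U → B × U`, given by
`Tr^U(f)(a) = π_B (f (a, fix (u ↦ π_U (f (a, u)))))`. -/
noncomputable def trace {A B U : Dom} (f : A.prod U ⟶c B.prod U) (a : A) : B :=
  (f (a, lfp ⟨fun u : U => (f (a, u)).2, by fun_prop⟩)).1

/-! ## Strict functions -/

/-- Strict continuous functions: the morphisms on which functors act. -/
structure SHom (D E : Dom) extends Hom D E where
  strict : toFun ⊥ = ⊥

namespace SHom

instance {D E : Dom} : CoeFun (SHom D E) (fun _ => D → E) := ⟨fun f => f.toFun⟩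

@[ext] theorem ext {D E : Dom} {f g : SHom D E} (h : ∀ x, f x = g x) : f = g := by
  obtain ⟨f, _⟩ := f
  obtain ⟨g, _⟩ := g
  congr 1
  exact Hom.ext h

theorem cont' {D E : Dom} (f : SHom D E) : ScottContinuous fun x => f x := f.cont

instance {D E : Dom} : LE (SHom D E) := ⟨fun f g => ∀ x, f x ≤ g x⟩

def id (D : Dom) : SHom D D := ⟨⟨fun x => x, ScottContinuous.fun_id⟩, rfl⟩

def comp {D E F : Dom} (g : SHom E F) (f : SHom D E) : SHom D F where
  toFun x := g (f x)
  cont := ScottContinuous.fun_comp f.cont g.cont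
  strict := by rw [f.strict, g.strict]

def zero (D E : Dom) : SHom D E := ⟨⟨fun _ => ⊥, ScottContinuous.fun_const _⟩, rfl⟩

/-- The family given by `f` on the first block of indices and by `g` on the second block. -/
def elim {ι κ : Type} {X Y : ι → Dom} {D E : κ → Dom} (f : ∀ i, SHom (X i) (Y i))
    (g : ∀ k, SHom (D k) (E k)) : ∀ j : ι ⊕ κ, SHom (Sum.elim X D j) (Sum.elim Y E j)
  | Sum.inl i => f i
  | Sum.inr k => g k

end SHom

attribute [fun_prop] SHom.cont'

/-! ## Bilimits -/

section Bilimit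
variable {D : ℕ → Dom} {p : ∀ n, SHom (D (n + 1)) (D n)}

theorem bilim_exists_isLUB {s : Set {x : ∀ n, D n // ∀ n, p n (x (n + 1)) = x n}}
    (h1 : s.Nonempty) (h2 : DirectedOn (· ≤ ·) s) :
    ∃ z : {x : ∀ n, D n // ∀ n, p n (x (n + 1)) = x n}, IsLUB s z ∧
      ∀ n, IsLUB ((fun x : {x : ∀ n, D n // ∀ n, p n (x (n + 1)) = x n} => x.1 n) '' s)
        (z.1 n) := by
  have hd : ∀ n, DirectedOn (· ≤ ·)
      ((fun x : {x : ∀ n, D n // ∀ n, p n (x (n + 1)) = x n} => x.1 n) '' s) :=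
    fun n => directedOn_image (by intro x y h; exact h n) h2
  choose z hz using fun n => (D n).dc _ (h1.image _) (hd n)
  refine ⟨⟨z, fun n => ?_⟩, ⟨fun x hx n => (hz n).1 ⟨x, hx, rfl⟩, fun y hy n => (hz n).2 ?_⟩, hz⟩
  · have := (p n).cont (h1.image _) (hd (n + 1)) (hz (n + 1))
    rw [Set.image_image] at this
    refine this.unique ?_
    convert hz n using 3 with x
    exact x.2 n
  · rintro _ ⟨x, hx, rfl⟩
    exact hy hx n

/-- The bilimit of a chain of domains with projections `pₙ : Dₙ₊₁ → Dₙ`: the domain of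
sequences `x` with `pₙ(xₙ₊₁) = xₙ`, ordered pointwise. -/
def Dom.bilim (D : ℕ → Dom) (p : ∀ n, SHom (D (n + 1)) (D n)) : Dom where
  carrier := {x : ∀ n, D n // ∀ n, p n (x (n + 1)) = x n}
  orderBot :=
    { bot := ⟨fun _ => ⊥, fun n => (p n).strict⟩
      bot_le := fun _ _ => bot_le }
  dc := fun _ h1 h2 => (bilim_exists_isLUB h1 h2).imp fun _ h => h.1

theorem cont_component (n : ℕ) : ScottContinuous fun x : Dom.bilim D p => x.1 n := by
  intro d h1 h2 a ha
  obtain ⟨z, hz, hz'⟩ := bilim_exists_isLUB (D := D) (p := p) h1 h2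
  rw [ha.unique hz]
  exact hz' n

theorem cont_toBilim {Z : Type} [PartialOrder Z] {f : Z → Dom.bilim D p}
    (hf : ∀ n, ScottContinuous fun z => (f z).1 n) : ScottContinuous f := by
  intro d h1 h2 a ha
  refine ⟨?_, fun y hy n => (hf n h1 h2 ha).2 ?_⟩
  · rintro _ ⟨x, hx, rfl⟩ n
    exact (hf n h1 h2 ha).1 ⟨x, hx, rfl⟩
  · rintro _ ⟨x, hx, rfl⟩
    exact hy ⟨x, hx, rfl⟩ n

end Bilimit

/-! ## Functors -/

/-- Polarities of session types; also the two aspects (negative and positive) of a type. -/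
inductive Pol
  | neg
  | pos

/-- A `κ`-tuple of locally monotone functors in `ι` variables on the category of domains and strict
continuous functions. -/
structure LFun (ι κ : Type) where
  obj : (ι → Dom) → κ → Dom
  map : ∀ {X Y : ι → Dom}, (∀ i, SHom (X i) (Y i)) → ∀ k, SHom (obj X k) (obj Y k)
  map_id : ∀ (X : ι → Dom) (k : κ), map (fun i => SHom.id (X i)) k = SHom.id (obj X k)
  map_comp : ∀ {X Y Z : ι → Dom} (g : ∀ i, SHom (Y i) (Z i)) (f : ∀ i, SHom (X i) (Y i)) (k : κ),
    map (fun i => (g i).comp (f i)) k = (map g k).comp (map f k)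
  map_mono : ∀ {X Y : ι → Dom} {f g : ∀ i, SHom (X i) (Y i)}, (∀ i, f i ≤ g i) →
    ∀ k, map f k ≤ map g k

namespace LFun
variable {ι κ μ : Type}

theorem map_congr (F : LFun ι κ) {X Y : ι → Dom} {f g : ∀ i, SHom (X i) (Y i)}
    (h : ∀ i x, f i x = g i x) (k : κ) : F.map f k = F.map g k := by
  rw [show f = g from funext fun i => SHom.ext (h i)]

theorem ext_of_eq {F G : LFun ι κ} (h : ∀ X k, F.obj X k = G.obj X k)
    (h' : ∀ {X Y : ι → Dom} (f : ∀ i, SHom (X i) (Y i)) (k : κ) (x : F.obj X k),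
      castDom (h Y k) (F.map f k x) = G.map f k (castDom (h X k) x)) : F = G := by
  obtain ⟨o, m, _, _, _⟩ := F
  obtain ⟨o', m', _, _, _⟩ := G
  obtain rfl : o = o' := funext fun X => funext fun k => h X k
  congr
  funext X Y f k
  exact SHom.ext fun x => h' f k x

theorem map_comp_apply (F : LFun ι κ) {X Y Z : ι → Dom} (g : ∀ i, SHom (Y i) (Z i))
    (f : ∀ i, SHom (X i) (Y i)) (k : κ) (x : F.obj X k) :
    F.map g k (F.map f k x) = F.map (fun i => (g i).comp (f i)) k x := by
  rw [F.map_comp]; rfl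

/-- Composition of tuples of functors. -/
def comp (G : LFun κ μ) (F : LFun ι κ) : LFun ι μ where
  obj X := G.obj (F.obj X)
  map f := G.map (F.map f)
  map_id X k := by
    rw [← G.map_id]; congr 1; funext k; exact F.map_id X k
  map_comp g f k := by
    rw [← G.map_comp]; congr 1; funext k; exact F.map_comp g f k
  map_mono h := G.map_mono (F.map_mono h)

/-- Projections, selected by `r : κ → ι`. -/
def select (r : κ → ι) : LFun ι κ where
  obj X k := X (r k)
  map f k := f (r k)
  map_id _ _ := rfl
  map_comp _ _ _ := rfl
  map_mono h k := h (r k)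

/-- Constant functors. -/
def const (ι : Type) (D : Dom) : LFun ι Unit where
  obj _ _ := D
  map _ _ := SHom.id D
  map_id _ _ := rfl
  map_comp _ _ _ := rfl
  map_mono _ _ _ := le_rfl

/-- Pointwise binary products. -/
def prod (F G : LFun ι Unit) : LFun ι Unit where
  obj X k := (F.obj X k).prod (G.obj X k)
  map f k :=
    { toFun := fun x => (F.map f k x.1, G.map f k x.2)
      cont := by fun_prop
      strict := Prod.ext (F.map f k).strict (G.map f k).strict }
  map_id X k := by
    ext x
    simp only [F.map_id, G.map_id]
    rfl
  map_comp g f k := by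
    ext x
    simp only [F.map_comp, G.map_comp]
    rfl
  map_mono h k x := ⟨F.map_mono h k x.1, G.map_mono h k x.2⟩

/-- Pointwise indexed products. -/
def pi {L : Type} (F : L → LFun ι Unit) : LFun ι Unit where
  obj X k := Dom.pi fun l => (F l).obj X k
  map f k :=
    { toFun := fun x l => (F l).map f k (x l)
      cont := by fun_prop
      strict := funext fun l => ((F l).map f k).strict }
  map_id X k := by
    ext x
    simp only [map_id]
    rfl
  map_comp g f k := by
    ext x
    simp only [map_comp]
    rfl
  map_mono h k x l := (F l).map_mono h k (x l)

/-- Pointwise lifting. -/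
def lift (F : LFun ι Unit) : LFun ι Unit where
  obj X k := (F.obj X k).lift
  map {X Y} f k :=
    { toFun := liftElim (E := (F.obj Y k).lift) fun x => (F.map f k x : WithBot (F.obj Y k))
      cont := cont_liftElim (E := (F.obj Y k).lift) (X := (F.obj X k).lift)
        (f := fun _ x => (F.map f k x : WithBot (F.obj Y k))) (g := fun x => x)
        (by fun_prop) (by fun_prop)
      strict := rfl }
  map_id X k := by
    ext x
    cases x
    · rfl
    · simp only [F.map_id]; rfl
  map_comp g f k := by
    ext x
    cases x
    · rfl
    · simp only [F.map_comp]; rfl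
  map_mono h k x := by
    cases x
    · exact le_rfl
    · exact WithBot.coe_le_coe.2 (F.map_mono h k _)

/-- Pointwise coalesced sums of liftings. -/
def sum {L : Type} (F : L → LFun ι Unit) : LFun ι Unit where
  obj X k := Dom.sum fun l => (F l).obj X k
  map {X Y} f k :=
    { toFun := liftElim (E := Dom.sum fun l => (F l).obj Y k)
        fun x : Σ l, (F l).obj X k =>
          ((⟨x.1, (F x.1).map f k x.2⟩ : Σ l, (F l).obj Y k) : WithBot (Σ l, (F l).obj Y k))
      cont := cont_liftElim (E := Dom.sum fun l => (F l).obj Y k)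
        (X := Dom.sum fun l => (F l).obj X k)
        (f := fun _ x =>
          ((⟨x.1, (F x.1).map f k x.2⟩ : Σ l, (F l).obj Y k) : WithBot (Σ l, (F l).obj Y k)))
        (g := fun x => x)
        (cont_sigma (D := fun l => (F l).obj X k)
          (f := fun (_ : Dom.sum fun l => (F l).obj X k) x =>
            ((⟨x.1, (F x.1).map f k x.2⟩ : Σ l, (F l).obj Y k) : WithBot (Σ l, (F l).obj Y k)))
          fun l => cont_coe (cont_sigmaMk (D := fun l => (F l).obj Y k)
            (f := fun p : _ × (F l).obj X k => (F l).map f k p.2) (by fun_prop)))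
        (by fun_prop)
      strict := rfl }
  map_id X k := by
    ext x
    cases x
    · rfl
    · simp only [map_id]; rfl
  map_comp g f k := by
    ext x
    cases x
    · rfl
    · simp only [map_comp]; rfl
  map_mono h k x := by
    rcases x with _ | ⟨l, x⟩
    · exact le_rfl
    · exact WithBot.coe_le_coe.2
        (Sigma.mk_le_mk_iff (α := fun l => ((F l).obj _ k).carrier) |>.2 ((F l).map_mono h k _))

/-- The empty tuple of functors. -/
def nil (ι : Type) : LFun ι Empty where
  obj _ := Empty.elim
  map _ k := k.elim
  map_id _ k := k.elim
  map_comp _ _ k := k.elim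
  map_mono _ k := k.elim

/-- Juxtaposition of tuples of functors. -/
def append (F : LFun ι κ) (G : LFun ι μ) : LFun ι (κ ⊕ μ) where
  obj X := Sum.elim (F.obj X) (G.obj X)
  map f := SHom.elim (F.map f) (G.map f)
  map_id X k := by
    cases k
    · exact F.map_id _ _
    · exact G.map_id _ _
  map_comp g f k := by
    cases k
    · exact F.map_comp _ _ _
    · exact G.map_comp _ _ _
  map_mono h k := by
    cases k
    · exact F.map_mono h _
    · exact G.map_mono h _

/-- The pair of functors with the given negative and positive components. -/
def pair (N P : LFun ι Unit) : LFun ι Pol where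
  obj X
    | Pol.neg => N.obj X ()
    | Pol.pos => P.obj X ()
  map f
    | Pol.neg => N.map f ()
    | Pol.pos => P.map f ()
  map_id X k := by
    cases k
    · exact N.map_id _ _
    · exact P.map_id _ _
  map_comp g f k := by
    cases k
    · exact N.map_comp _ _ _
    · exact P.map_comp _ _ _
  map_mono h k := by
    cases k
    · exact N.map_mono h _
    · exact P.map_mono h _

/-- The component of a tuple of functors at `k`. -/
def at' (F : LFun ι κ) (k : κ) : LFun ι Unit := (select fun _ => k).comp F

/-- `F` on the first block of variables, the identity on the second block. -/
def under (κ' : Type) (F : LFun ι κ) : LFun (ι ⊕ κ') (κ ⊕ κ') where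
  obj X := Sum.elim (F.obj fun i => X (Sum.inl i)) fun k => X (Sum.inr k)
  map f := SHom.elim (F.map fun i => f (Sum.inl i)) fun k => f (Sum.inr k)
  map_id X k := by
    cases k
    · exact F.map_id _ _
    · rfl
  map_comp g f k := by
    cases k
    · exact F.map_comp _ _ _
    · rfl
  map_mono h k := by
    cases k
    · exact F.map_mono (fun i => h (Sum.inl i)) _
    · exact h (Sum.inr _)

section Fix
variable (F : LFun (ι ⊕ κ) κ) (X : ι → Dom)

/-- The chain `1, F(X, 1), F(X, F(X, 1)), …`. -/
noncomputable def chain (n : ℕ) : κ → Dom :=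
  Nat.rec (fun _ => Dom.one) (fun _ D => F.obj (Sum.elim X D)) n

/-- The strict maps between the members of the chain: embeddings upwards and projections
downwards. -/
noncomputable def link : ∀ n m (k : κ), SHom (F.chain X n k) (F.chain X m k)
  | 0, _ => fun _ => SHom.zero _ _
  | _ + 1, 0 => fun _ => SHom.zero _ _
  | n + 1, m + 1 => F.map (SHom.elim (fun i => SHom.id (X i)) (link n m))

theorem link_comp_le (n k m : ℕ) (j : κ) (x : F.chain X n j) :
    F.link X k m j (F.link X n k j x) ≤ F.link X n m j x := by
  induction n generalizing k m j with
  | zero =>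
    have h : F.link X 0 k j x = ⊥ := by cases k <;> rfl
    rw [h, (F.link X k m j).strict]
    exact bot_le
  | succ n ih =>
    cases k with
    | zero =>
      have h : ∀ y, F.link X 0 m j y = ⊥ := fun y => by cases m <;> rfl
      rw [h]
      exact bot_le
    | succ k =>
      cases m with
      | zero => exact le_rfl
      | succ m =>
        refine (F.map_comp_apply _ _ j x).trans_le (F.map_mono ?_ j x)
        rintro (i | i)
        · exact fun y => le_rfl
        · exact fun y => ih k m i y

theorem link_comp (n k m : ℕ) (h : m ≤ k) (j : κ) (x : F.chain X n j) :
    F.link X k m j (F.link X n k j x) = F.link X n m j x := by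
  induction n generalizing k m j with
  | zero =>
    have h1 : ∀ k, F.link X 0 k j x = ⊥ := fun k => by cases k <;> rfl
    rw [h1, h1, (F.link X k m j).strict]
  | succ n ih =>
    cases m with
    | zero => cases k <;> rfl
    | succ m =>
      cases k with
      | zero => simp at h
      | succ k =>
        refine (F.map_comp_apply _ _ j x).trans ?_
        refine congrArg (fun e : SHom _ _ => e x) (F.map_congr ?_ j)
        rintro (i | i) y
        · rfl
        · exact ih k m (by omega) i y

/-- The canonical fixed point of `F(X, -)`: the bilimit of the chain `1, F(X, 1), …`. -/
noncomputable def fixObj (k : κ) : Dom := Dom.bilim (fun n => F.chain X n k) fun n => F.link X (n + 1) n k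

/-- The projection of the bilimit onto the `n`-th member of the chain. -/
noncomputable def fixProj (n : ℕ) (k : κ) : SHom (F.fixObj X k) (F.chain X n k) where
  toFun x := x.1 n
  cont := cont_component n
  strict := rfl

/-- The embedding of the `n`-th member of the chain into the bilimit. -/
noncomputable def fixEmb (n : ℕ) (k : κ) : SHom (F.chain X n k) (F.fixObj X k) where
  toFun x := ⟨fun m => F.link X n m k x, fun m => F.link_comp X n (m + 1) m (Nat.le_succ m) k x⟩
  cont := cont_toBilim fun m => (F.link X n m k).cont
  strict := Subtype.ext (funext fun m => (F.link X n m k).strict)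

/-- The object `F(X, Fix F X)`. -/
noncomputable def fixUnfolded (k : κ) : Dom := F.obj (Sum.elim X (F.fixObj X)) k

/-- The canonical map `Fold : F(X, Fix F X) → Fix F X`. -/
noncomputable def fold (k : κ) : F.fixUnfolded X k ⟶c F.fixObj X k where
  toFun y := ⟨fun n => match n with
    | 0 => ⊥
    | n + 1 => F.map (SHom.elim (fun i => SHom.id (X i)) (F.fixProj X n)) k y, by
      rintro (_ | n)
      · rfl
      · refine (F.map_comp_apply _ _ k y).trans ?_
        refine congrArg (fun e : SHom _ _ => e y) (F.map_congr ?_ k)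
        rintro (i | i) x
        · rfl
        · exact x.2 n⟩
  cont := by
    refine cont_toBilim fun n => ?_
    cases n with
    | zero => exact ScottContinuous.fun_const _
    | succ n => exact SHom.cont' _

/-- The `n`-th approximation `F(X, eₙ) ∘ πₙ₊₁` of `Unfold`. -/
noncomputable def unfoldApprox (k : κ) (n : ℕ) : (F.fixObj X k).fn (F.fixUnfolded X k) :=
  ((F.map (SHom.elim (fun i => SHom.id (X i)) (F.fixEmb X n)) k).comp (F.fixProj X (n + 1) k)).toHom

/-- The canonical map `Unfold : Fix F X → F(X, Fix F X)`, the inverse of `Fold`: the supremum of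
the ascending chain of its approximations. -/
noncomputable def unfold (k : κ) : F.fixObj X k ⟶c F.fixUnfolded X k :=
  ((F.fixObj X k).fn (F.fixUnfolded X k)).lub (Set.range (F.unfoldApprox X k))

variable {X}

/-- The action of the functor `X ↦ Fix F X` on the chain. -/
noncomputable def chainMap {Y : ι → Dom} (f : ∀ i, SHom (X i) (Y i)) (n : ℕ) :
    ∀ k : κ, SHom (F.chain X n k) (F.chain Y n k) :=
  Nat.rec (motive := fun n => ∀ k : κ, SHom (F.chain X n k) (F.chain Y n k))
    (fun _ => SHom.id _) (fun _ g => F.map (SHom.elim f g)) n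

theorem chainMap_link {Y : ι → Dom} (f : ∀ i, SHom (X i) (Y i)) (n : ℕ) (k : κ)
    (x : F.chain X (n + 1) k) :
    F.link Y (n + 1) n k (F.chainMap f (n + 1) k x) = F.chainMap f n k (F.link X (n + 1) n k x) := by
  induction n generalizing k with
  | zero => rfl
  | succ n ih =>
    refine (F.map_comp_apply _ _ k x).trans (Eq.trans ?_ (F.map_comp_apply _ _ k x).symm)
    refine congrArg (fun e : SHom _ _ => e x) (F.map_congr ?_ k)
    rintro (i | i) y
    · rfl
    · exact ih i y

theorem chainMap_id (n : ℕ) (k : κ) :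
    F.chainMap (fun i => SHom.id (X i)) n k = SHom.id (F.chain X n k) := by
  induction n generalizing k with
  | zero => rfl
  | succ n ih =>
    refine (F.map_congr ?_ k).trans (F.map_id _ k)
    rintro (i | i) y
    · rfl
    · exact congrArg (fun e : SHom _ _ => e y) (ih i)

theorem chainMap_comp {Y Z : ι → Dom} (g : ∀ i, SHom (Y i) (Z i)) (f : ∀ i, SHom (X i) (Y i))
    (n : ℕ) (k : κ) : F.chainMap (fun i => (g i).comp (f i)) n k =
      (F.chainMap g n k).comp (F.chainMap f n k) := by
  induction n generalizing k with
  | zero => rfl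
  | succ n ih =>
    refine (F.map_congr ?_ k).trans (F.map_comp _ _ k)
    rintro (i | i) y
    · rfl
    · exact congrArg (fun e : SHom _ _ => e y) (ih i)

theorem chainMap_mono {Y : ι → Dom} {f g : ∀ i, SHom (X i) (Y i)} (h : ∀ i, f i ≤ g i)
    (n : ℕ) (k : κ) : F.chainMap f n k ≤ F.chainMap g n k := by
  induction n generalizing k with
  | zero => exact fun _ => le_rfl
  | succ n ih =>
    refine F.map_mono ?_ k
    rintro (i | i)
    · exact h i
    · exact ih i

end Fix

/-- The tuple of functors whose values are the bilimits of a functorial family of chains. -/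
def ofChain (C : (ι → Dom) → ℕ → κ → Dom) (p : ∀ X n k, SHom (C X (n + 1) k) (C X n k))
    (m : ∀ {X Y : ι → Dom}, (∀ i, SHom (X i) (Y i)) → ∀ n k, SHom (C X n k) (C Y n k))
    (hp : ∀ {X Y : ι → Dom} (f : ∀ i, SHom (X i) (Y i)) (n : ℕ) (k : κ) (x : C X (n + 1) k),
      p Y n k (m f (n + 1) k x) = m f n k (p X n k x))
    (h_id : ∀ X n k, m (X := X) (Y := X) (fun i => SHom.id (X i)) n k = SHom.id (C X n k))
    (h_comp : ∀ {X Y Z : ι → Dom} (g : ∀ i, SHom (Y i) (Z i)) (f : ∀ i, SHom (X i) (Y i)) n k,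
      m (fun i => (g i).comp (f i)) n k = (m g n k).comp (m f n k))
    (h_mono : ∀ {X Y : ι → Dom} {f g : ∀ i, SHom (X i) (Y i)}, (∀ i, f i ≤ g i) →
      ∀ n k, m f n k ≤ m g n k) : LFun ι κ where
  obj X k := Dom.bilim (fun n => C X n k) fun n => p X n k
  map f k :=
    { toFun := fun x => ⟨fun n => m f n k (x.1 n), fun n => by rw [hp, x.2]⟩
      cont := cont_toBilim fun n => ScottContinuous.fun_comp (cont_component n) (m f n k).cont
      strict := Subtype.ext (funext fun n => (m f n k).strict) }
  map_id X k := by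
    ext x
    exact Subtype.ext (funext fun n => congrArg (fun e : SHom _ _ => e (x.1 n)) (h_id X n k))
  map_comp g f k := by
    ext x
    exact Subtype.ext (funext fun n => congrArg (fun e : SHom _ _ => e (x.1 n)) (h_comp g f n k))
  map_mono h k x n := h_mono h n k (x.1 n)

/-- The parametrized canonical fixed point `X ↦ Fix F X` of a tuple of functors `F`. -/
noncomputable def fix (F : LFun (ι ⊕ κ) κ) : LFun ι κ :=
  ofChain F.chain (fun X n => F.link X (n + 1) n) F.chainMap F.chainMap_link
    (fun _ => F.chainMap_id) F.chainMap_comp F.chainMap_mono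

theorem ofChain_congr {C : (ι → Dom) → ℕ → κ → Dom}
    {p p' : ∀ X n k, SHom (C X (n + 1) k) (C X n k)}
    {m : ∀ {X Y : ι → Dom}, (∀ i, SHom (X i) (Y i)) → ∀ n k, SHom (C X n k) (C Y n k)}
    {hp h_id h_comp h_mono hp'} (h : p = p') :
    ofChain C p m hp h_id h_comp h_mono = ofChain C p' m hp' h_id h_comp h_mono := by
  subst h
  rfl

theorem link_comp_under {ι' : Type} (F : LFun (ι ⊕ κ) κ) (H : LFun ι' ι) (X : ι' → Dom) (n m : ℕ)
    (k : κ) : F.link (H.obj X) n m k = (F.comp (H.under κ)).link X n m k := by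
  induction n generalizing m k with
  | zero => rfl
  | succ n ih =>
    cases m with
    | zero => rfl
    | succ m =>
      refine F.map_congr ?_ k
      rintro (i | i) x
      · exact (congrArg (fun e : SHom _ _ => e x) (H.map_id X i)).symm
      · exact congrArg (fun e : SHom _ _ => e x) (ih m i)

theorem fix_comp {ι' : Type} (F : LFun (ι ⊕ κ) κ) (H : LFun ι' ι) :
    (fix F).comp H = fix (F.comp (H.under κ)) := by
  refine ofChain_congr (hp := fun f => F.chainMap_link (H.map f)) (funext fun X => funext fun n => funext fun k => ?_)
  exact F.link_comp_under H X (n + 1) n k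

end LFun

/-! ## Session types and functional types -/

/-- `TVar Ξ p`: the type variables of polarity `p` in the context `Ξ` (de Bruijn indices). -/
inductive TVar : List Pol → Pol → Type
  | zero {Ξ : List Pol} {p : Pol} : TVar (p :: Ξ) p
  | succ {Ξ : List Pol} {p q : Pol} : TVar Ξ p → TVar (q :: Ξ) p

mutual

/-- `STy Ξ p`: the session types `A` with `Ξ ⊢ A type^p`, that is, the session types of polarity `p`
in a context `Ξ` of polarized type variables. -/
inductive STy : List Pol → Pol → Type
  | one {Ξ : List Pol} : STy Ξ Pol.pos
  | var {Ξ : List Pol} {p : Pol} : TVar Ξ p → STy Ξ p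
  /-- The recursive type `ρα.A`. -/
  | mu {Ξ : List Pol} {p : Pol} : STy (p :: Ξ) p → STy Ξ p
  /-- The shift `↓A`. -/
  | dshift {Ξ : List Pol} : STy Ξ Pol.neg → STy Ξ Pol.pos
  /-- The shift `↑A`. -/
  | ushift {Ξ : List Pol} : STy Ξ Pol.pos → STy Ξ Pol.neg
  /-- Internal choice `⊕{l : Aₗ}`, with labels drawn from a finite set of natural numbers. -/
  | plus {Ξ : List Pol} (L : Finset ℕ) : (L → STy Ξ Pol.pos) → STy Ξ Pol.pos
  /-- External choice `&{l : Aₗ}`. -/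
  | amp {Ξ : List Pol} (L : Finset ℕ) : (L → STy Ξ Pol.neg) → STy Ξ Pol.neg
  /-- Channel transmission `A ⊗ B`. -/
  | tensor {Ξ : List Pol} : STy Ξ Pol.pos → STy Ξ Pol.pos → STy Ξ Pol.pos
  /-- Channel reception `A ⊸ B`. -/
  | lolly {Ξ : List Pol} : STy Ξ Pol.pos → STy Ξ Pol.neg → STy Ξ Pol.neg
  /-- Value transmission `τ ∧ A`. -/
  | and {Ξ : List Pol} : FTy → STy Ξ Pol.pos → STy Ξ Pol.pos
  /-- Value reception `τ ⊃ A`. -/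
  | imp {Ξ : List Pol} : FTy → STy Ξ Pol.neg → STy Ξ Pol.neg

/-- Functional types. -/
inductive FTy : Type
  /-- The type `{a : A ← a₁ : A₁, …, aₙ : Aₙ}` of quoted processes.  The channel names are bound, so
  that only the list of (closed) session types is recorded. -/
  | proc {n : ℕ} {q : Fin n → Pol} {p : Pol} : (∀ i, STy [] (q i)) → STy [] p → FTy
  | arrow : FTy → FTy → FTy

end

/-- Extension of a renaming to contexts with one more variable. -/
def liftRen {Ξ Ξ' : List Pol} (r : ∀ q, TVar Ξ q → TVar Ξ' q) (p : Pol) :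
    ∀ q, TVar (p :: Ξ) q → TVar (p :: Ξ') q
  | _, .zero => .zero
  | q, .succ v => .succ (r q v)

/-- Renaming of type variables. -/
def STy.rename {Ξ Ξ' : List Pol} {p : Pol} (r : ∀ q, TVar Ξ q → TVar Ξ' q) : STy Ξ p → STy Ξ' p
  | .one => .one
  | .var v => .var (r _ v)
  | .mu A => .mu (A.rename (liftRen r _))
  | .dshift A => .dshift (A.rename r)
  | .ushift A => .ushift (A.rename r)
  | .plus L A => .plus L fun l => (A l).rename r
  | .amp L A => .amp L fun l => (A l).rename r
  | .tensor A B => .tensor (A.rename r) (B.rename r)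
  | .lolly A B => .lolly (A.rename r) (B.rename r)
  | .and τ A => .and τ (A.rename r)
  | .imp τ A => .imp τ (A.rename r)

/-- Extension of a substitution to contexts with one more variable. -/
def liftSub {Ξ Ξ' : List Pol} (s : ∀ q, TVar Ξ q → STy Ξ' q) (p : Pol) :
    ∀ q, TVar (p :: Ξ) q → STy (p :: Ξ') q
  | _, .zero => .var .zero
  | q, .succ v => (s q v).rename fun _ => .succ

/-- Simultaneous substitution of session types for type variables. -/
def STy.subst {Ξ Ξ' : List Pol} {p : Pol} (s : ∀ q, TVar Ξ q → STy Ξ' q) : STy Ξ p → STy Ξ' p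
  | .one => .one
  | .var v => s _ v
  | .mu A => .mu (A.subst (liftSub s _))
  | .dshift A => .dshift (A.subst s)
  | .ushift A => .ushift (A.subst s)
  | .plus L A => .plus L fun l => (A l).subst s
  | .amp L A => .amp L fun l => (A l).subst s
  | .tensor A B => .tensor (A.subst s) (B.subst s)
  | .lolly A B => .lolly (A.subst s) (B.subst s)
  | .and τ A => .and τ (A.subst s)
  | .imp τ A => .imp τ (A.subst s)

/-- The substitution of `B` for the only variable. -/
def single {p : Pol} (B : STy [] p) : ∀ q, TVar [p] q → STy [] q
  | _, .zero => B

/-- The unfolding `[ρα.A/α]A` of the recursive type `ρα.A`. -/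
def STy.unroll {p : Pol} (A : STy [p] p) : STy [] p := A.subst (single (.mu A))

/-! ## Denotations of types -/

/-- Indices for the aspects of the type variables of a context: each variable stands for a negative
and a positive aspect. -/
def TIdx : List Pol → Type
  | [] => Empty
  | _ :: Ξ => TIdx Ξ ⊕ Pol

/-- The index of an aspect of a variable. -/
def TVar.idx {Ξ : List Pol} {p : Pol} : TVar Ξ p → Pol → TIdx Ξ
  | .zero, q => Sum.inr q
  | .succ v, q => Sum.inl (v.idx q)

open LFun in
mutual

/-- The denotation of a session type: the pair of its negative and its positive aspect, both of them
functors of the aspects of the type variables.  A recursive type denotes the canonical fixed point of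
the pair of functors.  (The two aspects do not interact, and this is the pair of the two canonical fixed
points, unless the variable occurs to the left of a `⊸`.) -/
noncomputable def STy.sem {Ξ : List Pol} {p : Pol} : STy Ξ p → LFun (TIdx Ξ) Pol
  | .one => pair (const _ Dom.one) (lift (const _ Dom.one))
  | .var v => select v.idx
  | .mu A => fix A.sem
  | .dshift A => pair (A.sem.at' .neg) (lift (A.sem.at' .pos))
  | .ushift A => pair (lift (A.sem.at' .neg)) (A.sem.at' .pos)
  | .plus _ A => pair (pi fun l => (A l).sem.at' .neg) (sum fun l => (A l).sem.at' .pos)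
  | .amp _ A => pair (sum fun l => (A l).sem.at' .neg) (pi fun l => (A l).sem.at' .pos)
  | .tensor A B => pair (prod (A.sem.at' .neg) (B.sem.at' .neg))
      (lift (prod (A.sem.at' .pos) (B.sem.at' .pos)))
  | .lolly A B => pair (lift (prod (A.sem.at' .pos) (B.sem.at' .neg)))
      (prod (A.sem.at' .neg) (B.sem.at' .pos))
  | .and τ A => pair (A.sem.at' .neg) (lift (prod (const _ τ.sem) (A.sem.at' .pos)))
  | .imp τ A => pair (lift (prod (const _ τ.sem) (A.sem.at' .neg))) (A.sem.at' .pos)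

/-- The denotation of a functional type.  A quoted process denotes a lifted domain of continuous
functions from the inputs to the outputs on the channels; functions denote strict functions. -/
noncomputable def FTy.sem : FTy → Dom
  | .proc A B => Dom.lift (Dom.fn
      ((Dom.pi fun i => (A i).sem.obj Empty.elim .pos).prod (B.sem.obj Empty.elim .neg))
      ((Dom.pi fun i => (A i).sem.obj Empty.elim .neg).prod (B.sem.obj Empty.elim .pos)))
  | .arrow τ σ => Dom.strictFn τ.sem σ.sem

end

/-- The aspect `q` of the denotation of a closed session type. -/
noncomputable def STy.asp {p : Pol} (A : STy [] p) (q : Pol) : Dom := A.sem.obj Empty.elim q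

/-- The denotation of a substitution. -/
noncomputable def subSem {Ξ' : List Pol} : ∀ {Ξ : List Pol}, (∀ q, TVar Ξ q → STy Ξ' q) →
    LFun (TIdx Ξ') (TIdx Ξ)
  | [], _ => LFun.nil _
  | _ :: _, s => (subSem fun q v => s q (.succ v)).append (s _ .zero).sem

theorem subSem_var {Ξ : List Pol} {p : Pol} (v : TVar Ξ p) {Ξ' : List Pol}
    (s : ∀ q, TVar Ξ q → STy Ξ' q) : (s p v).sem = (LFun.select v.idx).comp (subSem s) := by
  induction v with
  | zero => rfl
  | succ v ih => exact ih fun q v => s q (.succ v)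

theorem subSem_weaken {Ξ Ξ' : List Pol} (r : ∀ q, TVar Ξ q → TVar Ξ' q) (p : Pol) :
    subSem (fun q v => STy.var (TVar.succ (q := p) (r q v))) =
      (subSem fun q v => STy.var (r q v)).comp (LFun.select Sum.inl) := by
  induction Ξ with
  | nil => rfl
  | cons q Ξ ih =>
    rw [subSem, ih fun q v => r q (.succ v)]
    rfl

theorem subSem_liftRen {Ξ Ξ' : List Pol} (r : ∀ q, TVar Ξ q → TVar Ξ' q) (p : Pol) :
    subSem (fun q v => STy.var (liftRen r p q v)) =
      (subSem fun q v => STy.var (r q v)).under Pol := by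
  rw [subSem]
  change (subSem fun q v => STy.var (TVar.succ (q := p) (r q v))).append _ = _
  rw [subSem_weaken]
  rfl

theorem STy.sem_rename {Ξ Ξ' : List Pol} {p : Pol} (r : ∀ q, TVar Ξ q → TVar Ξ' q) :
    ∀ A : STy Ξ p, (A.rename r).sem = A.sem.comp (subSem fun q v => STy.var (r q v))
  | .one => rfl
  | .var v => subSem_var v fun q v => STy.var (r q v)
  | .mu A => by
    rw [rename, STy.sem, sem_rename _ A, subSem_liftRen, STy.sem]
    exact (LFun.fix_comp _ _).symm
  | .dshift A => by rw [rename, STy.sem, sem_rename r A]; rfl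
  | .ushift A => by rw [rename, STy.sem, sem_rename r A]; rfl
  | .plus L A => by
    rw [rename, STy.sem]; simp only [fun l => sem_rename r (A l)]; rfl
  | .amp L A => by
    rw [rename, STy.sem]; simp only [fun l => sem_rename r (A l)]; rfl
  | .tensor A B => by rw [rename, STy.sem, sem_rename r A, sem_rename r B]; rfl
  | .lolly A B => by rw [rename, STy.sem, sem_rename r A, sem_rename r B]; rfl
  | .and τ A => by rw [rename, STy.sem, sem_rename r A]; rfl
  | .imp τ A => by rw [rename, STy.sem, sem_rename r A]; rfl

theorem subSem_id (Ξ : List Pol) :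
    (subSem fun q (v : TVar Ξ q) => STy.var v) = LFun.select id := by
  induction Ξ with
  | nil => exact LFun.ext_of_eq (fun _ k => k.elim) fun _ k => k.elim
  | cons q Ξ ih =>
    have h : (subSem fun q' (v : TVar Ξ q') => STy.var (TVar.succ (q := q) v)) =
        LFun.select Sum.inl := by
      rw [subSem_weaken (fun _ v => v) q, ih]
      rfl
    have h' : (subSem fun q' (v : TVar (q :: Ξ) q') => STy.var v) =
        (LFun.select (Sum.inl : TIdx Ξ → TIdx Ξ ⊕ Pol)).append (LFun.select Sum.inr) := by
      rw [← h]
      rfl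
    rw [h']
    refine LFun.ext_of_eq (fun X k => ?_) fun f k x => ?_
    · cases k <;> rfl
    · cases k <;> rfl

theorem subSem_succ (Ξ : List Pol) (p : Pol) :
    (subSem fun q (v : TVar Ξ q) => STy.var (TVar.succ (q := p) v)) = LFun.select Sum.inl := by
  rw [subSem_weaken (fun _ v => v) p, subSem_id]
  rfl

theorem subSem_liftSub {Ξ Ξ' : List Pol} (s : ∀ q, TVar Ξ q → STy Ξ' q) (p : Pol) :
    subSem (liftSub s p) = (subSem s).under Pol := by
  have h : ∀ {Ξ : List Pol} (s : ∀ q, TVar Ξ q → STy Ξ' q),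
      (subSem fun q v => (s q v).rename fun _ => TVar.succ (q := p)) =
        (subSem s).comp (LFun.select Sum.inl) := by
    intro Ξ s
    induction Ξ with
    | nil => rfl
    | cons q Ξ ih =>
      rw [subSem, ih, STy.sem_rename, subSem_succ]
      rfl
  rw [subSem]
  change (subSem fun q v => (s q v).rename fun _ => TVar.succ (q := p)).append _ = _
  rw [h]
  rfl

/-- Substitution of session types is composition of functors. -/
theorem STy.sem_subst {Ξ Ξ' : List Pol} {p : Pol} (s : ∀ q, TVar Ξ q → STy Ξ' q) :
    ∀ A : STy Ξ p, (A.subst s).sem = A.sem.comp (subSem s)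
  | .one => rfl
  | .var v => subSem_var v _
  | .mu A => by
    rw [subst, STy.sem, sem_subst _ A, subSem_liftSub, STy.sem]
    exact (LFun.fix_comp _ _).symm
  | .dshift A => by rw [subst, STy.sem, sem_subst s A]; rfl
  | .ushift A => by rw [subst, STy.sem, sem_subst s A]; rfl
  | .plus L A => by
    rw [subst, STy.sem]; simp only [fun l => sem_subst s (A l)]; rfl
  | .amp L A => by
    rw [subst, STy.sem]; simp only [fun l => sem_subst s (A l)]; rfl
  | .tensor A B => by rw [subst, STy.sem, sem_subst s A, sem_subst s B]; rfl
  | .lolly A B => by rw [subst, STy.sem, sem_subst s A, sem_subst s B]; rfl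
  | .and τ A => by rw [subst, STy.sem, sem_subst s A]; rfl
  | .imp τ A => by rw [subst, STy.sem, sem_subst s A]; rfl

/-- The domains of the unfolding of `ρα.A` are `F(Fix F)`, where `F` is the denotation of `A`. -/
theorem STy.asp_unroll {p : Pol} (A : STy [p] p) (q : Pol) :
    A.unroll.asp q = A.sem.fixUnfolded Empty.elim q := by
  rw [asp, unroll, sem_subst]
  rfl

/-- `Fold` on the aspect `q` of the recursive type `ρα.A`. -/
noncomputable def STy.fold {p : Pol} (A : STy [p] p) (q : Pol) :
    A.unroll.asp q ⟶c (STy.mu A).asp q :=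
  ⟨fun x => A.sem.fold Empty.elim q (castDom (A.asp_unroll q) x),
    ScottContinuous.fun_comp (cont_castDom _) (Hom.cont _)⟩

/-- `Unfold` on the aspect `q` of the recursive type `ρα.A`. -/
noncomputable def STy.unfold {p : Pol} (A : STy [p] p) (q : Pol) :
    (STy.mu A).asp q ⟶c A.unroll.asp q :=
  ⟨fun x => castDom (A.asp_unroll q).symm (A.sem.unfold Empty.elim q x),
    ScottContinuous.fun_comp (Hom.cont _) (cont_castDom _)⟩


section
variable {X : Type} [PartialOrder X] {p : Pol} (A : STy [p] p) (q : Pol)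

theorem STy.cont_fold {f : X → A.unroll.asp q} (hf : ScottContinuous f) :
    ScottContinuous fun x => A.fold q (f x) := ScottContinuous.fun_comp hf (A.fold q).cont

theorem STy.cont_unfold {f : X → (STy.mu A).asp q} (hf : ScottContinuous f) :
    ScottContinuous fun x => A.unfold q (f x) := ScottContinuous.fun_comp hf (A.unfold q).cont

end
/-! ## Contexts -/

/-- Names of channels and of functional variables. -/
abbrev Name := ℕ

/-- Closed session types, of either polarity. -/
abbrev CTy := Σ p : Pol, STy [] p

/-- A context is a finite partial function from names to types. -/
abbrev Ctx (T : Type) := Finmap fun _ : Name => T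

/-- Contexts of channels. -/
abbrev SCtx := Ctx CTy

/-- Contexts of functional variables. -/
abbrev FCtx := Ctx FTy

/-- The one-element context `a : A`. -/
def Ctx.single {T : Type} (a : Name) (A : T) : Ctx T := Finmap.singleton a A

/-- `Comma Δ [Δ₁, …, Δₙ]` says that the context `Δ₁, …, Δₙ` is well formed, no name being declared
twice, and that it is `Δ` (up to the order of the declarations). -/
def Comma {T : Type} (Δ : Ctx T) (L : List (Ctx T)) : Prop :=
  L.Pairwise Finmap.Disjoint ∧ Δ = L.foldr (· ∪ ·) ∅

/-- The aspect `q` of a closed session type. -/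
noncomputable def CTy.asp (A : CTy) (q : Pol) : Dom := A.2.asp q

/-- The aspect `q` of the type of a name in a context; a point, if the name is not declared. -/
noncomputable def declAsp (q : Pol) : Option CTy → Dom
  | none => Dom.one
  | some A => A.asp q

/-- The denotation of the type of a variable in a context; a point, if it is not declared. -/
noncomputable def declSem : Option FTy → Dom
  | none => Dom.one
  | some τ => τ.sem

/-- `⟦Δ⟧^q`: the product of the aspects `q` of the channels in `Δ`. -/
noncomputable def SCtx.sem (Δ : SCtx) (q : Pol) : Dom := Dom.pi fun c : Name => declAsp q (Δ.lookup c)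

/-- `⟦Ψ⟧`: the product of the denotations of the variables in `Ψ`. -/
noncomputable def FCtx.sem (Ψ : FCtx) : Dom := Dom.pi fun x : Name => declSem (Ψ.lookup x)

theorem declAsp_of_eq {q : Pol} {A : CTy} {o : Option CTy} (h : o = some A) :
    declAsp q o = A.asp q := by rw [h]; rfl

theorem declSem_of_eq {τ : FTy} {o : Option FTy} (h : o = some τ) : declSem o = τ.sem := by
  rw [h]; rfl

section Wiring
variable {q : Pol} {X : Type} [PartialOrder X]

open Classical in
/-- The component at `a`. -/
noncomputable def get {Δ : SCtx} (a : Name) (A : CTy) (x : Δ.sem q) : A.asp q :=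
  if h : Δ.lookup a = some A then castDom (declAsp_of_eq h) (x a) else ⊥

open Classical in
/-- The restriction of a tuple to a smaller context. -/
noncomputable def res {Γ Δ : SCtx} (x : Δ.sem q) : Γ.sem q := fun c =>
  if h : Δ.lookup c = Γ.lookup c then castDom (D := declAsp q (Δ.lookup c)) (congrArg (declAsp q) h) (x c) else ⊥

open Classical in
/-- The tuple whose component at `a` is `v`, and whose other components are those of `x`. -/
noncomputable def upd {Γ Δ : SCtx} (a : Name) (A : CTy) (v : A.asp q) (x : Δ.sem q) : Γ.sem q := fun c =>
  if h : c = a ∧ Γ.lookup c = some A then castDom (declAsp_of_eq h.2).symm v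
  else res x c

open Classical in
/-- The juxtaposition of a tuple for `Δ₁` and a tuple for `Δ₂`. -/
noncomputable def join {Γ Δ₁ Δ₂ : SCtx} (x : Δ₁.sem q) (y : Δ₂.sem q) : Γ.sem q := fun c =>
  if c ∈ Δ₁ then res x c else res y c

open Classical in
/-- The tuple with the components `v i` at the names `a i`. -/
noncomputable def ofPi {Γ : SCtx} {n : ℕ} (a : Fin n → Name) (A : Fin n → CTy)
    (v : ∀ i, (A i).asp q) : Γ.sem q := fun c =>
  if h : ∃ i, c = a i ∧ Γ.lookup c = some (A i) then
    castDom (declAsp_of_eq h.choose_spec.2).symm (v h.choose)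
  else ⊥

open Classical in
/-- The value of the variable `x`. -/
noncomputable def FCtx.get {Ψ : FCtx} (x : Name) (τ : FTy) (u : Ψ.sem) : τ.sem :=
  if h : Ψ.lookup x = some τ then castDom (declSem_of_eq h) (u x) else ⊥

open Classical in
/-- The environment `[u | x ↦ v]`. -/
noncomputable def FCtx.upd {Φ Ψ : FCtx} (x : Name) (τ : FTy) (v : τ.sem) (u : Ψ.sem) : Φ.sem := fun y =>
  if h : y = x ∧ Φ.lookup y = some τ then castDom (declSem_of_eq h.2).symm v
  else if h : Ψ.lookup y = Φ.lookup y then castDom (D := declSem (Ψ.lookup y)) (congrArg declSem h) (u y) else ⊥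

theorem cont_castDom' {D E : Dom} (h : D = E) {f : X → D} (hf : ScottContinuous f) :
    ScottContinuous fun x => castDom h (f x) := ScottContinuous.fun_comp hf (cont_castDom h)

theorem cont_component' {I : Type} {D : I → Dom} {f : X → Dom.pi D} (hf : ScottContinuous f) (i : I) :
    ScottContinuous fun x => f x i := ScottContinuous.fun_comp hf (cont_apply i)

@[fun_prop] theorem cont_get {Δ : SCtx} {a : Name} {A : CTy} {f : X → Δ.sem q}
    (hf : ScottContinuous f) : ScottContinuous fun x => get a A (f x) := by
  unfold get
  split
  · exact cont_castDom' _ (cont_component' hf _)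
  · exact ScottContinuous.fun_const _

@[fun_prop] theorem cont_res {Γ Δ : SCtx} {f : X → Δ.sem q} (hf : ScottContinuous f) :
    ScottContinuous fun x => (res (f x) : Γ.sem q) := by
  refine cont_pi fun c => ?_
  unfold res
  split
  · exact cont_castDom' _ (cont_component' hf _)
  · exact ScottContinuous.fun_const _

@[fun_prop] theorem cont_upd {Γ Δ : SCtx} {a : Name} {A : CTy} {g : X → A.asp q} {f : X → Δ.sem q}
    (hg : ScottContinuous g) (hf : ScottContinuous f) :
    ScottContinuous fun x => (upd a A (g x) (f x) : Γ.sem q) := by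
  refine cont_pi fun c => ?_
  unfold upd
  split
  · exact cont_castDom' _ hg
  · exact cont_component' (cont_res hf) c

@[fun_prop] theorem cont_join {Γ Δ₁ Δ₂ : SCtx} {f : X → Δ₁.sem q} {g : X → Δ₂.sem q}
    (hf : ScottContinuous f) (hg : ScottContinuous g) :
    ScottContinuous fun x => (join (f x) (g x) : Γ.sem q) := by
  refine cont_pi fun c => ?_
  unfold join
  split
  · exact cont_component' (cont_res hf) c
  · exact cont_component' (cont_res hg) c

@[fun_prop] theorem cont_ofPi {Γ : SCtx} {n : ℕ} {a : Fin n → Name} {A : Fin n → CTy}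
    {f : X → Dom.pi fun i => (A i).asp q} (hf : ScottContinuous f) :
    ScottContinuous fun x => (ofPi a A (f x) : Γ.sem q) := by
  refine cont_pi fun c => ?_
  unfold ofPi
  split
  · exact cont_castDom' _ (cont_component' hf _)
  · exact ScottContinuous.fun_const _

@[fun_prop] theorem FCtx.cont_get {Ψ : FCtx} {y : Name} {τ : FTy} {f : X → Ψ.sem}
    (hf : ScottContinuous f) : ScottContinuous fun x => FCtx.get y τ (f x) := by
  unfold FCtx.get
  split
  · exact cont_castDom' _ (cont_component' hf _)
  · exact ScottContinuous.fun_const _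

@[fun_prop] theorem FCtx.cont_upd {Φ Ψ : FCtx} {y : Name} {τ : FTy} {g : X → τ.sem} {f : X → Ψ.sem}
    (hg : ScottContinuous g) (hf : ScottContinuous f) :
    ScottContinuous fun x => (FCtx.upd y τ (g x) (f x) : Φ.sem) := by
  refine cont_pi fun z => ?_
  unfold FCtx.upd
  split
  · exact cont_castDom' _ hg
  · split
    · exact cont_castDom' _ (cont_component' hf _)
    · exact ScottContinuous.fun_const _

end Wiring

/-- `⟦Δ ⊢ c : C⟧`: the domain of continuous functions `⟦Δ⟧⁺ × ⟦C⟧⁻ → ⟦Δ⟧⁻ × ⟦C⟧⁺`. -/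
noncomputable def Beh (Δ : SCtx) (C : CTy) : Dom :=
  Dom.fn ((Δ.sem .pos).prod (C.asp .neg)) ((Δ.sem .neg).prod (C.asp .pos))

/-! ## The semantic clauses

Each operation maps the denotations of the premises of a rule to the denotation of its conclusion.
Here `U` is the domain of environments; in `P u (x, y)` the tuple `x` collects the positive aspects
of the channels in the context, and `y` is the negative aspect of the provided channel. -/

section Clauses
variable {X : Type} [PartialOrder X] {U V D E : Dom}

/-- `u ↦ (x ↦ f u x)`, for jointly continuous `f`. -/
def mk (f : U → D → E) (h : ScottContinuous fun p : U × D => f p.1 p.2) : U ⟶c D.fn E where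
  toFun := lam f fun u => ScottContinuous.fun_comp (f := fun x => (u, x)) (by fun_prop) h
  cont := cont_lam h _

/-- The unit `D → D_⊥`. -/
def up (D : Dom) (d : D) : D.lift := (d : WithBot D)

@[fun_prop] theorem cont_up {f : X → D} (hf : ScottContinuous f) :
    ScottContinuous fun x => up D (f x) := cont_coe hf

/-- Strict pattern matching on `↑d`: `⊥ ↦ ⊥` and `↑d ↦ f d`. -/
def onUp (D E : Dom) (f : D → E) (x : D.lift) : E := liftElim f x

@[fun_prop] theorem cont_onUp {f : X → D → E} {g : X → D.lift}
    (hf : ScottContinuous fun p : X × D => f p.1 p.2) (hg : ScottContinuous g) :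
    ScottContinuous fun x => onUp D E (f x) (g x) := cont_liftElim hf hg

/-- The tagged element `(k, ↑d)` of a coalesced sum of liftings. -/
def tag {I : Type} (D : I → Dom) (k : I) (d : D k) : Dom.sum D :=
  ((⟨k, d⟩ : Σ l, D l) : WithBot (Σ l, D l))

@[fun_prop] theorem cont_tag {I : Type} {D : I → Dom} {k : I} {f : X → D k}
    (hf : ScottContinuous f) : ScottContinuous fun x => tag D k (f x) := cont_coe (cont_sigmaMk hf)

/-- Strict pattern matching on `(k, ↑d)`: `⊥ ↦ ⊥` and `(k, ↑d) ↦ f k d`. -/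
def onTag {I : Type} (D : I → Dom) (E : Dom) (f : ∀ k, D k → E) (x : Dom.sum D) : E :=
  liftElim (fun v : Σ l, D l => f v.1 v.2) x

@[fun_prop] theorem cont_onTag {I : Type} {D : I → Dom} {f : X → ∀ k, D k → E} {g : X → Dom.sum D}
    (hf : ∀ k, ScottContinuous fun p : X × D k => f p.1 k p.2) (hg : ScottContinuous g) :
    ScottContinuous fun x => onTag D E (f x) (g x) :=
  cont_liftElim (cont_sigma (f := fun x (v : Σ l, D l) => f x v.1 v.2) hf) hg

open Classical in
/-- The tuple that is `d` at `k` and `⊥` elsewhere. -/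
noncomputable def only {I : Type} (D : I → Dom) (k : I) (d : D k) : Dom.pi D := fun l =>
  if h : k = l then castDom (congrArg D h) d else ⊥

@[fun_prop] theorem cont_only {I : Type} {D : I → Dom} {k : I} {f : X → D k}
    (hf : ScottContinuous f) : ScottContinuous fun x => only D k (f x) := by
  refine cont_pi fun l => ?_
  unfold only
  split
  · exact cont_castDom' _ hf
  · exact ScottContinuous.fun_const _

@[fun_prop] theorem cont_mk {f : U → D → E} (h : ScottContinuous fun p : U × D => f p.1 p.2)
    {g : X → U} (hg : ScottContinuous g) : ScottContinuous fun x => (mk f h).toFun (g x) :=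
  ScottContinuous.fun_comp hg (mk f h).cont

theorem cont_trace {A B : Dom} {F : X → (A.prod U ⟶c B.prod U)} {a : X → A}
    (hF : ScottContinuous F) (ha : ScottContinuous a) :
    ScottContinuous fun x => trace (F x) (a x) := by
  have h : ScottContinuous fun p : X × U => (F p.1 (a p.1, p.2)).2 := by
    fun_prop
  have h' := cont_lfp (D := U) (cont_lam (f := fun x u => (F x (a x, u)).2) h
    fun x => ScottContinuous.fun_comp (f := fun u => (x, u)) (by fun_prop) h)
  have h'' : ScottContinuous fun x => (F x (a x,
    lfp (lam (fun x u => (F x (a x, u)).2)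
      (fun x => ScottContinuous.fun_comp (f := fun u => (x, u)) (by fun_prop) h) x))).1 := by
    fun_prop
  exact h''

section Proc
variable {Δ Γ Γ₁ Γ₂ : SCtx} {C : CTy}

/-- Forwarding. -/
noncomputable def fwdSem (a : Name) (A : CTy) : U ⟶c Beh Δ A :=
  mk (fun _ x => (upd a A x.2 (⊥ : Δ.sem .neg), get a A x.1)) (by fun_prop)

/-- The function `⟦P⟧u × ⟦Q⟧u` on `(⟦Δ⟧⁺ × ⟦C⟧⁻) × (⟦A⟧⁻ × ⟦A⟧⁺)` up to the order of the factors: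
`w = (a⁻, a⁺)` are the values of both aspects of the shared channel `a`. -/
noncomputable def cutBody (a : Name) (A : CTy) (P : U ⟶c Beh Γ₁ A) (Q : U ⟶c Beh Γ₂ C) (u : U)
    (p : ((Δ.sem .pos).prod (C.asp .neg)).prod ((A.asp .neg).prod (A.asp .pos))) :
    ((Δ.sem .neg).prod (C.asp .pos)).prod ((A.asp .neg).prod (A.asp .pos)) :=
  let y : (Γ₁.sem .neg).prod (A.asp .pos) := (P u).toFun (res p.1.1, p.2.1)
  let z : (Γ₂.sem .neg).prod (C.asp .pos) := (Q u).toFun (upd a A p.2.2 p.1.1, p.1.2)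
  ((join y.1 z.1, z.2), (get a A z.1, y.2))

/-- Cut: the trace that feeds back both aspects of the channel `a`. -/
noncomputable def cutSem (a : Name) (A : CTy) (P : U ⟶c Beh Γ₁ A) (Q : U ⟶c Beh Γ₂ C) :
    U ⟶c Beh Δ C :=
  have h : ScottContinuous fun p : U × ((((Δ.sem .pos).prod (C.asp .neg)).prod
      ((A.asp .neg).prod (A.asp .pos))) : Dom) => cutBody a A P Q p.1 p.2 := by
    unfold cutBody
    fun_prop
  mk (fun u => trace ((mk (cutBody a A P Q) h).toFun u)) (cont_trace (by fun_prop) (by fun_prop))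

/-- `1R`. -/
noncomputable def closeSem : U ⟶c Beh Δ ⟨_, .one⟩ :=
  mk (fun _ _ => (⊥, up Dom.one PUnit.unit)) (ScottContinuous.fun_const _)

/-- `1L`: the output on `a` is trivial. -/
noncomputable def waitSem (a : Name) (P : U ⟶c Beh Γ C) : U ⟶c Beh Δ C :=
  mk (fun u x => onUp Dom.one ((Δ.sem .neg).prod (C.asp .pos)) (fun _ =>
    (res ((P u).toFun (res x.1, x.2)).1, ((P u).toFun (res x.1, x.2)).2))
    (get a ⟨_, .one⟩ x.1)) (by fun_prop)

/-- `↓R`. -/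
noncomputable def dshiftRSem (A : STy [] .neg) (P : U ⟶c Beh Δ ⟨_, A⟩) :
    U ⟶c Beh Δ ⟨_, .dshift A⟩ :=
  mk (fun u x => (((P u).toFun x).1, up (A.asp .pos) ((P u).toFun x).2)) (by fun_prop)

/-- `↓L`. -/
noncomputable def dshiftLSem (a : Name) (A : STy [] .neg) (P : U ⟶c Beh Γ C) : U ⟶c Beh Δ C :=
  mk (fun u x => onUp (A.asp .pos) ((Δ.sem .neg).prod (C.asp .pos)) (fun v =>
      let y := (P u).toFun (upd a ⟨_, A⟩ v x.1, x.2)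
      (upd a ⟨_, .dshift A⟩ (get a ⟨_, A⟩ y.1) y.1, y.2)) (get a ⟨_, .dshift A⟩ x.1))
    (by fun_prop)

/-- `↑R`. -/
noncomputable def ushiftRSem (A : STy [] .pos) (P : U ⟶c Beh Δ ⟨_, A⟩) :
    U ⟶c Beh Δ ⟨_, .ushift A⟩ :=
  mk (fun u x => onUp (A.asp .neg) ((Δ.sem .neg).prod (A.asp .pos))
    (fun v => (P u).toFun (x.1, v)) x.2) (by fun_prop)

/-- `↑L`. -/
noncomputable def ushiftLSem (a : Name) (A : STy [] .pos) (P : U ⟶c Beh Γ C) : U ⟶c Beh Δ C :=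
  mk (fun u x =>
    let y := (P u).toFun (upd a ⟨_, A⟩ (get a ⟨_, .ushift A⟩ x.1 : A.asp .pos) x.1, x.2)
    (upd a ⟨_, .ushift A⟩ (up (A.asp .neg) (get a ⟨_, A⟩ y.1)) y.1, y.2)) (by fun_prop)

/-- `⊕Rₖ`. -/
noncomputable def plusRSem {L : Finset ℕ} (A : L → STy [] .pos) (k : L)
    (P : U ⟶c Beh Δ ⟨_, A k⟩) : U ⟶c Beh Δ ⟨_, .plus L A⟩ :=
  mk (fun u x =>
    let v : Dom.pi fun l => (A l).asp .neg := x.2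
    let y := (P u).toFun (x.1, v k)
    (y.1, tag (fun l => (A l).asp .pos) k y.2)) (by fun_prop)

/-- `⊕L`. -/
noncomputable def plusLSem (a : Name) {L : Finset ℕ} (A : L → STy [] .pos) {Γ : L → SCtx}
    (P : ∀ l, U ⟶c Beh (Γ l) C) : U ⟶c Beh Δ C :=
  mk (fun u x => onTag (fun l => (A l).asp .pos) ((Δ.sem .neg).prod (C.asp .pos)) (fun k v =>
      let y := (P k u).toFun (upd a ⟨_, A k⟩ v x.1, x.2)
      (upd a ⟨_, .plus L A⟩ (only (fun l => (A l).asp .neg) k (get a ⟨_, A k⟩ y.1)) y.1, y.2))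
    (get a ⟨_, .plus L A⟩ x.1)) (by fun_prop)

/-- `&R`. -/
noncomputable def ampRSem {L : Finset ℕ} (A : L → STy [] .neg)
    (P : ∀ l, U ⟶c Beh Δ ⟨_, A l⟩) : U ⟶c Beh Δ ⟨_, .amp L A⟩ :=
  mk (fun u x => onTag (fun l => (A l).asp .neg)
    ((Δ.sem .neg).prod (Dom.pi fun l => (A l).asp .pos)) (fun k v =>
      let y := (P k u).toFun (x.1, v)
      (y.1, only (fun l => (A l).asp .pos) k y.2)) x.2) (by fun_prop)

/-- `&Lₖ`. -/
noncomputable def ampLSem (a : Name) {L : Finset ℕ} (A : L → STy [] .neg) (k : L)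
    (P : U ⟶c Beh Γ C) : U ⟶c Beh Δ C :=
  mk (fun u x =>
    let v : Dom.pi fun l => (A l).asp .pos := get a ⟨_, .amp L A⟩ x.1
    let y := (P u).toFun (upd a ⟨_, A k⟩ (v k) x.1, x.2)
    (upd a ⟨_, .amp L A⟩ (tag (fun l => (A l).asp .neg) k (get a ⟨_, A k⟩ y.1)) y.1, y.2))
    (by fun_prop)

/-- `⊗R*`: the channel `b` is sent on `a`. -/
noncomputable def tensorRSem (b : Name) (B A : STy [] .pos) (P : U ⟶c Beh Γ ⟨_, A⟩) :
    U ⟶c Beh Δ ⟨_, .tensor B A⟩ :=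
  mk (fun u x =>
    let v : (B.asp .neg).prod (A.asp .neg) := x.2
    let y := (P u).toFun (res x.1, v.2)
    (upd b ⟨_, B⟩ v.1 y.1, up ((B.asp .pos).prod (A.asp .pos)) (get b ⟨_, B⟩ x.1, y.2)))
    (by fun_prop)

/-- `⊗L`: the channel `b` is received on `a`. -/
noncomputable def tensorLSem (a b : Name) (B A : STy [] .pos) (P : U ⟶c Beh Γ C) : U ⟶c Beh Δ C :=
  mk (fun u x => onUp ((B.asp .pos).prod (A.asp .pos)) ((Δ.sem .neg).prod (C.asp .pos)) (fun v =>
      let y := (P u).toFun (upd b ⟨_, B⟩ v.1 (upd a ⟨_, A⟩ v.2 x.1 : Γ.sem .pos), x.2)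
      (upd a ⟨_, .tensor B A⟩ (get b ⟨_, B⟩ y.1, get a ⟨_, A⟩ y.1) y.1, y.2))
    (get a ⟨_, .tensor B A⟩ x.1)) (by fun_prop)

/-- `⊸R`: the channel `b` is received on `a`. -/
noncomputable def lollyRSem (b : Name) (B : STy [] .pos) (A : STy [] .neg)
    (P : U ⟶c Beh Γ ⟨_, A⟩) : U ⟶c Beh Δ ⟨_, .lolly B A⟩ :=
  mk (fun u x => onUp ((B.asp .pos).prod (A.asp .neg))
    ((Δ.sem .neg).prod ((B.asp .neg).prod (A.asp .pos))) (fun v =>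
      let y := (P u).toFun (upd b ⟨_, B⟩ v.1 x.1, v.2)
      (res y.1, (get b ⟨_, B⟩ y.1, y.2))) x.2) (by fun_prop)

/-- `⊸L`: the channel `b` is sent on `a`. -/
noncomputable def lollyLSem (a b : Name) (B : STy [] .pos) (A : STy [] .neg)
    (P : U ⟶c Beh Γ C) : U ⟶c Beh Δ C :=
  mk (fun u x =>
    let v : (B.asp .neg).prod (A.asp .pos) := get a ⟨_, .lolly B A⟩ x.1
    let y := (P u).toFun (upd a ⟨_, A⟩ v.2 x.1, x.2)
    (upd a ⟨_, .lolly B A⟩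
        (up ((B.asp .pos).prod (A.asp .neg)) (get b ⟨_, B⟩ x.1, get a ⟨_, A⟩ y.1))
      (upd b ⟨_, B⟩ v.1 y.1 : Δ.sem .neg), y.2)) (by fun_prop)

/-- `∧R`: a value is sent; the output is `⊥` if the term diverges. -/
noncomputable def andRSem (τ : FTy) (A : STy [] .pos) (M : U ⟶c τ.sem) (P : U ⟶c Beh Δ ⟨_, A⟩) :
    U ⟶c Beh Δ ⟨_, .and τ A⟩ :=
  mk (fun u x =>
    let y := (P u).toFun x
    strictIn (E := (Δ.sem .neg).prod ((τ.sem.prod (A.asp .pos)).lift)) (M u)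
      (y.1, up (τ.sem.prod (A.asp .pos)) (M u, y.2))) (by fun_prop)

/-- `∧L`: a value `v` is received; `e u v` is the environment `[u | x ↦ v]`. -/
noncomputable def andLSem (a : Name) (τ : FTy) (A : STy [] .pos) (e : U → τ.sem → V)
    (he : ScottContinuous fun p : U × τ.sem => e p.1 p.2) (P : V ⟶c Beh Γ C) : U ⟶c Beh Δ C :=
  mk (fun u x => onUp (τ.sem.prod (A.asp .pos)) ((Δ.sem .neg).prod (C.asp .pos)) (fun v =>
      let y := (P (e u v.1)).toFun (upd a ⟨_, A⟩ v.2 x.1, x.2)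
      (upd a ⟨_, .and τ A⟩ (get a ⟨_, A⟩ y.1) y.1, y.2))
    (get a ⟨_, .and τ A⟩ x.1)) (by fun_prop)

/-- `⊃R`: a value `v` is received; `e u v` is the environment `[u | x ↦ v]`. -/
noncomputable def impRSem (τ : FTy) (A : STy [] .neg) (e : U → τ.sem → V)
    (he : ScottContinuous fun p : U × τ.sem => e p.1 p.2) (P : V ⟶c Beh Δ ⟨_, A⟩) :
    U ⟶c Beh Δ ⟨_, .imp τ A⟩ :=
  mk (fun u x => onUp (τ.sem.prod (A.asp .neg)) ((Δ.sem .neg).prod (A.asp .pos))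
    (fun v => (P (e u v.1)).toFun (x.1, v.2)) x.2) (by fun_prop)

/-- `⊃L`: a value is sent; the output is `⊥` if the term diverges. -/
noncomputable def impLSem (a : Name) (τ : FTy) (A : STy [] .neg) (M : U ⟶c τ.sem)
    (P : U ⟶c Beh Γ C) : U ⟶c Beh Δ C :=
  mk (fun u x =>
    let y := (P u).toFun (upd a ⟨_, A⟩ (get a ⟨_, .imp τ A⟩ x.1 : A.asp .pos) x.1, x.2)
    strictIn (E := (Δ.sem .neg).prod (C.asp .pos)) (M u)
      (upd a ⟨_, .imp τ A⟩ (up (τ.sem.prod (A.asp .neg)) (M u, get a ⟨_, A⟩ y.1)) y.1, y.2))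
    (by fun_prop)

/-- `ρR`, for both polarities. -/
noncomputable def muRSem {p : Pol} (A : STy [p] p) (P : U ⟶c Beh Δ ⟨p, A.unroll⟩) :
    U ⟶c Beh Δ ⟨p, .mu A⟩ :=
  mk (fun u x =>
    let y := (P u).toFun (x.1, A.unfold .neg x.2)
    (y.1, A.fold .pos y.2)) (by
      have h : ScottContinuous fun t : U × ((Δ.sem .pos).prod ((STy.mu A).asp .neg)) =>
          (P t.1).toFun (t.2.1, A.unfold .neg t.2.2) :=
        cont_eval (by fun_prop)
          (ScottContinuous.prodMk (by fun_prop) (A.cont_unfold .neg (by fun_prop)))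
      exact ScottContinuous.prodMk (ScottContinuous.fun_comp h ScottContinuous.fst)
        (A.cont_fold .pos (ScottContinuous.fun_comp h ScottContinuous.snd)))

/-- `ρL`, for both polarities. -/
noncomputable def muLSem (a : Name) {p : Pol} (A : STy [p] p) (P : U ⟶c Beh Γ C) : U ⟶c Beh Δ C :=
  mk (fun u x =>
    let y := (P u).toFun (upd a ⟨p, A.unroll⟩ (A.unfold .pos (get a ⟨p, .mu A⟩ x.1)) x.1, x.2)
    (upd a ⟨p, .mu A⟩ (A.fold .neg (get a ⟨p, A.unroll⟩ y.1)) y.1, y.2)) (by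
      have h : ScottContinuous fun t : U × ((Δ.sem .pos).prod (C.asp .neg)) =>
          (P t.1).toFun (upd a ⟨p, A.unroll⟩ (A.unfold .pos (get a ⟨p, .mu A⟩ t.2.1)) t.2.1,
            t.2.2) :=
        cont_eval (by fun_prop) (ScottContinuous.prodMk (cont_upd (A.cont_unfold .pos
          (cont_get (by fun_prop))) (by fun_prop)) (by fun_prop))
      have h' := ScottContinuous.fun_comp h ScottContinuous.fst
      exact ScottContinuous.prodMk (cont_upd (A.cont_fold .neg (cont_get h')) h')
        (ScottContinuous.fun_comp h ScottContinuous.snd))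

/-- The domain of the behaviours with the channels `A₁, …, Aₙ` used and `B` provided, in which the
channels are identified by their positions. -/
noncomputable def PosBeh {n : ℕ} {q : Fin n → Pol} (A : ∀ i, STy [] (q i)) {p : Pol} (B : STy [] p) :
    Dom :=
  Dom.fn ((Dom.pi fun i => (A i).asp .pos).prod (B.asp .neg))
    ((Dom.pi fun i => (A i).asp .neg).prod (B.asp .pos))

/-- Execution of a quoted process (`E-{}`) with the channels `a₁ : A₁, …, aₙ : Aₙ`. -/
noncomputable def execSem {n : ℕ} (a : Fin n → Name) {q : Fin n → Pol} (A : ∀ i, STy [] (q i))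
    {p : Pol} (B : STy [] p) (M : U ⟶c (FTy.proc A B).sem) : U ⟶c Beh Δ ⟨p, B⟩ :=
  mk (fun u x =>
    let y := (down (D := PosBeh A B) (M u)).toFun (fun i => get (a i) ⟨q i, A i⟩ x.1, x.2)
    (ofPi a (fun i => ⟨q i, A i⟩) y.1, y.2)) (by fun_prop)

/-- Quotation of a process (`I-{}`) with the channels `a₁ : A₁, …, aₙ : Aₙ`. -/
noncomputable def quoteSem {n : ℕ} (a : Fin n → Name) {q : Fin n → Pol} (A : ∀ i, STy [] (q i))
    {p : Pol} (B : STy [] p) (P : U ⟶c Beh Δ ⟨p, B⟩) : U ⟶c (FTy.proc A B).sem where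
  toFun u := up (PosBeh A B) ((mk (fun u (x : (Dom.pi fun i => (A i).asp .pos).prod (B.asp .neg)) =>
    let y := (P u).toFun (ofPi a (fun i => ⟨q i, A i⟩) x.1, x.2)
    (fun i => get (a i) ⟨q i, A i⟩ y.1, y.2)) (by fun_prop)).toFun u)
  cont := cont_up (D := PosBeh A B) (Hom.cont _)

end Proc

/-- Fixed points of terms; `e u v` is the environment `[u | x ↦ v]`. -/
noncomputable def recSem (τ : FTy) (e : U → τ.sem → V)
    (he : ScottContinuous fun p : U × τ.sem => e p.1 p.2) (M : V ⟶c τ.sem) : U ⟶c τ.sem where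
  toFun u := lfp ((mk (fun u v => M (e u v)) (by fun_prop)).toFun u)
  cont := cont_lfp (Hom.cont _)

theorem cont_strictFn {f : X → Dom.strictFn D E} (hf : ScottContinuous fun x => (f x).1) :
    ScottContinuous f := by
  intro d h1 h2 a ha
  have h := hf h1 h2 ha
  refine ⟨?_, fun y hy => h.2 ?_⟩
  · rintro _ ⟨x, hx, rfl⟩
    exact h.1 ⟨x, hx, rfl⟩
  · rintro _ ⟨x, hx, rfl⟩
    exact hy ⟨x, hx, rfl⟩

theorem cont_strictFn_val : ScottContinuous fun f : Dom.strictFn D E => f.1 := by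
  intro d h1 h2 a ha
  refine isLUB_hom fun x => ?_
  have h3 : DirectedOn (· ≤ ·) (Subtype.val '' d) := by
    rintro _ ⟨f, hf, rfl⟩ _ ⟨g, hg, rfl⟩
    obtain ⟨k, hk, h1, h2⟩ := h2 f hf g hg
    exact ⟨_, ⟨k, hk, rfl⟩, h1, h2⟩
  obtain ⟨g, hg⟩ := Hom.exists_isLUB E.dc (h1.image Subtype.val) h3
  have hb : g ⊥ = ⊥ := by
    refine le_antisymm ((hg ⊥).2 ?_) bot_le
    rintro _ ⟨_, ⟨f, _, rfl⟩, rfl⟩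
    exact f.2.le
  have hl : IsLUB d (⟨g, hb⟩ : Dom.strictFn D E) := by
    refine ⟨fun f hf => (isLUB_hom hg).1 ⟨f, hf, rfl⟩, fun k hk => (isLUB_hom hg).2 ?_⟩
    rintro _ ⟨f, hf, rfl⟩
    exact hk hf
  rw [ha.unique hl]
  exact hg x

/-- Functions: the strict function that agrees with the body on arguments other than `⊥`. -/
noncomputable def funSem (τ σ : FTy) (e : U → τ.sem → V)
    (he : ScottContinuous fun p : U × τ.sem => e p.1 p.2) (M : V ⟶c σ.sem) :
    U ⟶c (FTy.arrow τ σ).sem where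
  toFun u := ⟨(mk (fun u v => strictIn v (M (e u v))) (by fun_prop)).toFun u, if_pos rfl⟩
  cont := cont_strictFn (D := τ.sem) (E := σ.sem)
    (mk (fun u v => strictIn v (M (e u v))) (by fun_prop)).cont

/-- Application. -/
noncomputable def appSem (τ σ : FTy) (M : U ⟶c (FTy.arrow τ σ).sem) (N : U ⟶c τ.sem) :
    U ⟶c σ.sem where
  toFun u := (M u).1 (N u)
  cont := cont_eval (ScottContinuous.fun_comp M.cont cont_strictFn_val) N.cont

end Clauses
/-! ## Terms and processes

A session-typed process is given by its typing derivation.  In each rule the contexts of the premises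
and of the conclusion are named, and the `Comma` hypotheses say how they are composed. -/

mutual

/-- `Tm Ψ τ`: the functional terms `M` with `Ψ ⊩ M : τ`. -/
inductive Tm : FCtx → FTy → Type
  /-- `x` -/
  | var {Ψ : FCtx} {τ : FTy} (x : Name) (h : Ψ.lookup x = some τ) : Tm Ψ τ
  /-- `fix x.M` -/
  | fixp {Ψ Φ : FCtx} {τ : FTy} (x : Name) (h : Comma Φ [Ψ, .single x τ]) (M : Tm Φ τ) : Tm Ψ τ
  /-- `λx : τ.M` -/
  | lam {Ψ Φ : FCtx} {τ σ : FTy} (x : Name) (h : Comma Φ [Ψ, .single x τ]) (M : Tm Φ σ) :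
      Tm Ψ (.arrow τ σ)
  /-- `M N` -/
  | app {Ψ : FCtx} {τ σ : FTy} (M : Tm Ψ (.arrow τ σ)) (N : Tm Ψ τ) : Tm Ψ σ
  /-- `b ← {P} ← a₁, …, aₙ`, a quoted process -/
  | quote {Ψ : FCtx} {Δ : SCtx} {n : ℕ} {q : Fin n → Pol} {A : ∀ i, STy [] (q i)} {p : Pol}
      {B : STy [] p} (a : Fin n → Name) (b : Name)
      (h : Comma Δ (List.ofFn fun i => .single (a i) ⟨q i, A i⟩)) (P : Proc Ψ Δ b ⟨p, B⟩) :
      Tm Ψ (.proc A B)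

/-- `Proc Ψ Δ c C`: the processes `P` with `Ψ; Δ ⊢ P :: c : C`.  Such a process uses the channels in
`Δ` and provides the channel `c`, which is not declared in `Δ`. -/
inductive Proc : FCtx → SCtx → Name → CTy → Type
  /-- `Ψ; a : A ⊢ a → b :: b : A` -/
  | fwd {Ψ : FCtx} (a b : Name) (A : CTy) (h : b ≠ a) : Proc Ψ (.single a A) b A
  /-- From `Ψ; Δ₁ ⊢ P :: a : A` and `Ψ; a : A, Δ₂ ⊢ Q :: c : C` one has
  `Ψ; Δ₁, Δ₂ ⊢ a ← P; Q :: c : C`. -/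
  | cut {Ψ : FCtx} {Δ₁ Δ₂ Γ Δ : SCtx} {c : Name} {A C : CTy} (a : Name)
      (hQ : Comma Γ [.single a A, Δ₂]) (h : Comma Δ [Δ₁, Δ₂]) (hc : c ∉ Δ)
      (P : Proc Ψ Δ₁ a A) (Q : Proc Ψ Γ c C) : Proc Ψ Δ c C
  /-- `Ψ; · ⊢ close a :: a : 1` -/
  | close {Ψ : FCtx} (a : Name) : Proc Ψ ∅ a ⟨_, .one⟩
  /-- From `Ψ; Δ ⊢ P :: c : C` one has `Ψ; Δ, a : 1 ⊢ wait a; P :: c : C`. -/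
  | wait {Ψ : FCtx} {Δ Γ : SCtx} {c : Name} {C : CTy} (a : Name)
      (h : Comma Γ [Δ, .single a ⟨_, .one⟩]) (hc : c ∉ Γ) (P : Proc Ψ Δ c C) : Proc Ψ Γ c C
  /-- From `Ψ; Δ ⊢ P :: a : A` one has `Ψ; Δ ⊢ send a shift; P :: a : ↓A`. -/
  | dshiftR {Ψ : FCtx} {Δ : SCtx} {a : Name} {A : STy [] .neg} (P : Proc Ψ Δ a ⟨_, A⟩) :
      Proc Ψ Δ a ⟨_, .dshift A⟩
  /-- From `Ψ; Δ, a : A ⊢ P :: c : C` one has `Ψ; Δ, a : ↓A ⊢ shift ← recv a; P :: c : C`. -/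
  | dshiftL {Ψ : FCtx} {Δ Γ Γ' : SCtx} {c : Name} {C : CTy} (a : Name) (A : STy [] .neg)
      (h : Comma Γ [Δ, .single a ⟨_, A⟩]) (h' : Comma Γ' [Δ, .single a ⟨_, .dshift A⟩])
      (P : Proc Ψ Γ c C) : Proc Ψ Γ' c C
  /-- From `Ψ; Δ ⊢ P :: a : A` one has `Ψ; Δ ⊢ shift ← recv a; P :: a : ↑A`. -/
  | ushiftR {Ψ : FCtx} {Δ : SCtx} {a : Name} {A : STy [] .pos} (P : Proc Ψ Δ a ⟨_, A⟩) :
      Proc Ψ Δ a ⟨_, .ushift A⟩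
  /-- From `Ψ; Δ, a : A ⊢ P :: c : C` one has `Ψ; Δ, a : ↑A ⊢ send a shift; P :: c : C`. -/
  | ushiftL {Ψ : FCtx} {Δ Γ Γ' : SCtx} {c : Name} {C : CTy} (a : Name) (A : STy [] .pos)
      (h : Comma Γ [Δ, .single a ⟨_, A⟩]) (h' : Comma Γ' [Δ, .single a ⟨_, .ushift A⟩])
      (P : Proc Ψ Γ c C) : Proc Ψ Γ' c C
  /-- From `Ψ; Δ ⊢ P :: a : Aₖ` one has `Ψ; Δ ⊢ a.k; P :: a : ⊕{l : Aₗ}`. -/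
  | plusR {Ψ : FCtx} {Δ : SCtx} {a : Name} {L : Finset ℕ} {A : L → STy [] .pos} (k : L)
      (P : Proc Ψ Δ a ⟨_, A k⟩) : Proc Ψ Δ a ⟨_, .plus L A⟩
  /-- From `Ψ; Δ, a : Aₗ ⊢ Pₗ :: c : C` for all `l` one has
  `Ψ; Δ, a : ⊕{l : Aₗ} ⊢ case a {l ⇒ Pₗ} :: c : C`. -/
  | plusL {Ψ : FCtx} {Δ Γ' : SCtx} {c : Name} {C : CTy} (a : Name) {L : Finset ℕ}
      (A : L → STy [] .pos) {Γ : L → SCtx} (h : ∀ l, Comma (Γ l) [Δ, .single a ⟨_, A l⟩])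
      (h' : Comma Γ' [Δ, .single a ⟨_, .plus L A⟩]) (hc : c ∉ Γ')
      (P : ∀ l, Proc Ψ (Γ l) c C) : Proc Ψ Γ' c C
  /-- From `Ψ; Δ ⊢ Pₗ :: a : Aₗ` for all `l` one has `Ψ; Δ ⊢ case a {l ⇒ Pₗ} :: a : &{l : Aₗ}`. -/
  | ampR {Ψ : FCtx} {Δ : SCtx} {a : Name} {L : Finset ℕ} {A : L → STy [] .neg} (ha : a ∉ Δ)
      (P : ∀ l, Proc Ψ Δ a ⟨_, A l⟩) : Proc Ψ Δ a ⟨_, .amp L A⟩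
  /-- From `Ψ; Δ, a : Aₖ ⊢ P :: c : C` one has `Ψ; Δ, a : &{l : Aₗ} ⊢ a.k; P :: c : C`. -/
  | ampL {Ψ : FCtx} {Δ Γ Γ' : SCtx} {c : Name} {C : CTy} (a : Name) {L : Finset ℕ}
      (A : L → STy [] .neg) (k : L) (h : Comma Γ [Δ, .single a ⟨_, A k⟩])
      (h' : Comma Γ' [Δ, .single a ⟨_, .amp L A⟩]) (P : Proc Ψ Γ c C) : Proc Ψ Γ' c C
  /-- From `Ψ; Δ ⊢ P :: a : A` one has `Ψ; Δ, b : B ⊢ send a b; P :: a : B ⊗ A`. -/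
  | tensorR {Ψ : FCtx} {Δ Γ : SCtx} {a : Name} (b : Name) (B : STy [] .pos) {A : STy [] .pos}
      (h : Comma Γ [Δ, .single b ⟨_, B⟩]) (ha : a ∉ Γ) (P : Proc Ψ Δ a ⟨_, A⟩) :
      Proc Ψ Γ a ⟨_, .tensor B A⟩
  /-- From `Ψ; Δ, a : A, b : B ⊢ P :: c : C` one has
  `Ψ; Δ, a : B ⊗ A ⊢ b ← recv a; P :: c : C`. -/
  | tensorL {Ψ : FCtx} {Δ Γ Γ' : SCtx} {c : Name} {C : CTy} (a b : Name) (B A : STy [] .pos)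
      (h : Comma Γ [Δ, .single a ⟨_, A⟩, .single b ⟨_, B⟩])
      (h' : Comma Γ' [Δ, .single a ⟨_, .tensor B A⟩]) (P : Proc Ψ Γ c C) : Proc Ψ Γ' c C
  /-- From `Ψ; Δ, b : B ⊢ P :: a : A` one has `Ψ; Δ ⊢ b ← recv a; P :: a : B ⊸ A`. -/
  | lollyR {Ψ : FCtx} {Δ Γ : SCtx} {a : Name} (b : Name) (B : STy [] .pos) {A : STy [] .neg}
      (h : Comma Γ [Δ, .single b ⟨_, B⟩]) (P : Proc Ψ Γ a ⟨_, A⟩) : Proc Ψ Δ a ⟨_, .lolly B A⟩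
  /-- From `Ψ; Δ, a : A ⊢ P :: c : C` one has
  `Ψ; Δ, b : B, a : B ⊸ A ⊢ send a b; P :: c : C`. -/
  | lollyL {Ψ : FCtx} {Δ Γ Γ' : SCtx} {c : Name} {C : CTy} (a b : Name) (B : STy [] .pos)
      (A : STy [] .neg) (h : Comma Γ [Δ, .single a ⟨_, A⟩])
      (h' : Comma Γ' [Δ, .single b ⟨_, B⟩, .single a ⟨_, .lolly B A⟩]) (hc : c ∉ Γ')
      (P : Proc Ψ Γ c C) : Proc Ψ Γ' c C
  /-- From `Ψ ⊩ M : τ` and `Ψ; Δ ⊢ P :: a : A` one has `Ψ; Δ ⊢ send a M; P :: a : τ ∧ A`. -/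
  | andR {Ψ : FCtx} {Δ : SCtx} {a : Name} {τ : FTy} {A : STy [] .pos} (M : Tm Ψ τ)
      (P : Proc Ψ Δ a ⟨_, A⟩) : Proc Ψ Δ a ⟨_, .and τ A⟩
  /-- From `Ψ, x : τ; Δ, a : A ⊢ P :: c : C` one has
  `Ψ; Δ, a : τ ∧ A ⊢ x ← recv a; P :: c : C`. -/
  | andL {Ψ Φ : FCtx} {Δ Γ Γ' : SCtx} {c : Name} {C : CTy} (a x : Name) (τ : FTy)
      (A : STy [] .pos) (hx : Comma Φ [Ψ, .single x τ]) (h : Comma Γ [Δ, .single a ⟨_, A⟩])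
      (h' : Comma Γ' [Δ, .single a ⟨_, .and τ A⟩]) (P : Proc Φ Γ c C) : Proc Ψ Γ' c C
  /-- From `Ψ, x : τ; Δ ⊢ P :: a : A` one has `Ψ; Δ ⊢ x ← recv a; P :: a : τ ⊃ A`. -/
  | impR {Ψ Φ : FCtx} {Δ : SCtx} {a : Name} (x : Name) (τ : FTy) {A : STy [] .neg}
      (hx : Comma Φ [Ψ, .single x τ]) (P : Proc Φ Δ a ⟨_, A⟩) : Proc Ψ Δ a ⟨_, .imp τ A⟩
  /-- From `Ψ ⊩ M : τ` and `Ψ; Δ, a : A ⊢ P :: c : C` one has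
  `Ψ; Δ, a : τ ⊃ A ⊢ send a M; P :: c : C`. -/
  | impL {Ψ : FCtx} {Δ Γ Γ' : SCtx} {c : Name} {C : CTy} (a : Name) (τ : FTy) (A : STy [] .neg)
      (h : Comma Γ [Δ, .single a ⟨_, A⟩]) (h' : Comma Γ' [Δ, .single a ⟨_, .imp τ A⟩])
      (M : Tm Ψ τ) (P : Proc Ψ Γ c C) : Proc Ψ Γ' c C
  /-- From `Ψ; Δ ⊢ P :: a : [ρα.A/α]A` one has `Ψ; Δ ⊢ send a unfold; P :: a : ρα.A` if `ρα.A` is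
  positive, and `Ψ; Δ ⊢ unfold ← recv a; P :: a : ρα.A` if it is negative. -/
  | muR {Ψ : FCtx} {Δ : SCtx} {a : Name} {p : Pol} {A : STy [p] p}
      (P : Proc Ψ Δ a ⟨p, A.unroll⟩) : Proc Ψ Δ a ⟨p, .mu A⟩
  /-- From `Ψ; Δ, a : [ρα.A/α]A ⊢ P :: c : C` one has
  `Ψ; Δ, a : ρα.A ⊢ unfold ← recv a; P :: c : C` if `ρα.A` is positive, and
  `Ψ; Δ, a : ρα.A ⊢ send a unfold; P :: c : C` if it is negative. -/
  | muL {Ψ : FCtx} {Δ Γ Γ' : SCtx} {c : Name} {C : CTy} (a : Name) {p : Pol} (A : STy [p] p)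
      (h : Comma Γ [Δ, .single a ⟨p, A.unroll⟩]) (h' : Comma Γ' [Δ, .single a ⟨p, .mu A⟩])
      (P : Proc Ψ Γ c C) : Proc Ψ Γ' c C
  /-- From `Ψ ⊩ M : {b : B ← a₁ : A₁, …, aₙ : Aₙ}` one has
  `Ψ; a₁ : A₁, …, aₙ : Aₙ ⊢ b ← {M} ← a₁, …, aₙ :: b : B`. -/
  | exec {Ψ : FCtx} {Δ : SCtx} {n : ℕ} {q : Fin n → Pol} {A : ∀ i, STy [] (q i)} {p : Pol}
      {B : STy [] p} (a : Fin n → Name) (b : Name)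
      (h : Comma Δ (List.ofFn fun i => .single (a i) ⟨q i, A i⟩)) (hb : b ∉ Δ)
      (M : Tm Ψ (.proc A B)) : Proc Ψ Δ b ⟨p, B⟩

end

theorem FCtx.cont_upd' {Φ Ψ : FCtx} (x : Name) (τ : FTy) :
    ScottContinuous fun p : Ψ.sem × τ.sem => (FCtx.upd x τ p.2 p.1 : Φ.sem) := by fun_prop

mutual

/-- The denotation `⟦Ψ ⊩ M : τ⟧`. -/
noncomputable def Tm.sem {Ψ : FCtx} {τ : FTy} : Tm Ψ τ → (Ψ.sem ⟶c τ.sem)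
  | .var (Ψ := Ψ) (τ := τ) x _ => ⟨fun u : Ψ.sem => FCtx.get x τ u, by fun_prop⟩
  | .fixp (Ψ := Ψ) (Φ := Φ) (τ := τ) x _ M =>
      recSem τ (fun u v => FCtx.upd x τ v u) (FCtx.cont_upd' x τ) M.sem
  | .lam (Ψ := Ψ) (Φ := Φ) (τ := τ) (σ := σ) x _ M =>
      funSem τ σ (fun u v => FCtx.upd x τ v u) (FCtx.cont_upd' x τ) M.sem
  | .app M N => appSem _ _ M.sem N.sem
  | .quote a _ _ P => quoteSem a _ _ P.sem

/-- The denotation `⟦Ψ; Δ ⊢ P :: c : C⟧`. -/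
noncomputable def Proc.sem {Ψ : FCtx} {Δ : SCtx} {c : Name} {C : CTy} :
    Proc Ψ Δ c C → (Ψ.sem ⟶c Beh Δ C)
  | .fwd a _ A _ => fwdSem a A
  | .cut a _ _ _ P Q => cutSem a _ P.sem Q.sem
  | .close _ => closeSem
  | .wait a _ _ P => waitSem a P.sem
  | .dshiftR P => dshiftRSem _ P.sem
  | .dshiftL a A _ _ P => dshiftLSem a A P.sem
  | .ushiftR P => ushiftRSem _ P.sem
  | .ushiftL a A _ _ P => ushiftLSem a A P.sem
  | .plusR k P => plusRSem _ k P.sem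
  | .plusL a A _ _ _ P => plusLSem a A fun l => (P l).sem
  | .ampR _ P => ampRSem _ fun l => (P l).sem
  | .ampL a A k _ _ P => ampLSem a A k P.sem
  | .tensorR b B _ _ P => tensorRSem b B _ P.sem
  | .tensorL a b B A _ _ P => tensorLSem a b B A P.sem
  | .lollyR b B _ P => lollyRSem b B _ P.sem
  | .lollyL a b B A _ _ _ P => lollyLSem a b B A P.sem
  | .andR M P => andRSem _ _ M.sem P.sem
  | .andL a x τ A _ _ _ P =>
      andLSem a τ A (fun u v => FCtx.upd x τ v u) (FCtx.cont_upd' x τ) P.sem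
  | .impR x τ _ P =>
      impRSem τ _ (fun u v => FCtx.upd x τ v u) (FCtx.cont_upd' x τ) P.sem
  | .impL a τ A _ _ M P => impLSem a τ A M.sem P.sem
  | .muR P => muRSem _ P.sem
  | .muL a A _ _ P => muLSem a A P.sem
  | .exec a _ _ _ M => execSem a _ _ M.sem

end
/-- `P ≡ Q`: the processes `P` and `Q` have the same denotation. -/
def Proc.Equiv {Ψ : FCtx} {Δ : SCtx} {c : Name} {C : CTy} (P Q : Proc Ψ Δ c C) : Prop :=
  P.sem = Q.sem

/-! ## Well-formedness of contexts -/

section Comma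
variable {T : Type} {Δ Γ Δ₁ Δ₂ Δ₃ : Ctx T} {a b c : Name} {A B : T}

theorem Ctx.mem_single : c ∈ Ctx.single a A ↔ c = a := Finmap.mem_singleton c a A

theorem Comma.mem {L : List (Ctx T)} (h : Comma Δ L) : c ∈ Δ ↔ ∃ Γ ∈ L, c ∈ Γ := by
  obtain ⟨_, rfl⟩ := h
  induction L with
  | nil => simpa using Finmap.notMem_empty
  | cons Γ L ih => simp_all

theorem Comma.mem₂ (h : Comma Δ [Δ₁, Δ₂]) : c ∈ Δ ↔ c ∈ Δ₁ ∨ c ∈ Δ₂ := by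
  simp [h.mem]

theorem Comma.mem₃ (h : Comma Δ [Δ₁, Δ₂, Δ₃]) : c ∈ Δ ↔ c ∈ Δ₁ ∨ c ∈ Δ₂ ∨ c ∈ Δ₃ := by
  simp [h.mem]

theorem comma₂ (h : Δ₁.Disjoint Δ₂) : Comma (Δ₁ ∪ Δ₂) [Δ₁, Δ₂] := by
  refine ⟨by simpa using h, ?_⟩
  simp

theorem Comma.symm (h : Comma Δ [Δ₁, Δ₂]) : Comma Δ [Δ₂, Δ₁] := by
  obtain ⟨h, rfl⟩ := h
  have h : Δ₁.Disjoint Δ₂ := by simpa using h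
  refine ⟨by simpa using h.symm, ?_⟩
  simpa using Finmap.union_comm_of_disjoint h

theorem Comma.assoc (h : Comma Δ [Δ₁, Δ₂, Δ₃]) : Comma Δ [Δ₁, Δ₂ ∪ Δ₃] := by
  obtain ⟨h, rfl⟩ := h
  obtain ⟨⟨h1, h2⟩, h3⟩ : (Δ₁.Disjoint Δ₂ ∧ Δ₁.Disjoint Δ₃) ∧ Δ₂.Disjoint Δ₃ := by
    simpa using h
  refine ⟨?_, by simp⟩
  simpa using (Finmap.disjoint_union_right Δ₁ Δ₂ Δ₃).2 ⟨h1, h2⟩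

/-- Cyclic exchange. -/
theorem Comma.rotate (h : Comma Δ [Δ₁, Δ₂, Δ₃]) : Comma Δ [Δ₂, Δ₃, Δ₁] := by
  obtain ⟨h', rfl⟩ := h.assoc.symm
  obtain ⟨⟨h1, h2⟩, h3⟩ : (Δ₁.Disjoint Δ₂ ∧ Δ₁.Disjoint Δ₃) ∧ Δ₂.Disjoint Δ₃ := by
    simpa using h.1
  refine ⟨by simpa using ⟨⟨h3, h1.symm⟩, h2.symm⟩, ?_⟩
  simp [Finmap.union_assoc]

theorem Comma.swap (h : Comma Δ [Δ₁, Δ₂, Δ₃]) : Comma Δ [Δ₂, Δ₁, Δ₃] := by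
  obtain ⟨h', rfl⟩ := h.rotate.assoc.symm
  obtain ⟨⟨h1, h2⟩, h3⟩ : (Δ₁.Disjoint Δ₂ ∧ Δ₁.Disjoint Δ₃) ∧ Δ₂.Disjoint Δ₃ := by
    simpa using h.1
  refine ⟨by simpa using ⟨⟨h1.symm, h3⟩, h2⟩, ?_⟩
  have h4 : Δ₂.Disjoint (Δ₃ ∪ Δ₁) := (Finmap.disjoint_union_right _ _ _).2 ⟨h3, h1.symm⟩
  simpa [Finmap.union_comm_of_disjoint h2] using (Finmap.union_comm_of_disjoint h4).symm

theorem Comma.assoc' (h : Comma Δ [Δ₁, Δ₂, Δ₃]) : Comma Δ [Δ₁ ∪ Δ₂, Δ₃] :=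
  h.rotate.rotate.assoc.symm

theorem Comma.disj₁₂ (h : Comma Δ [Δ₁, Δ₂, Δ₃]) : Δ₁.Disjoint Δ₂ := by
  obtain ⟨⟨h1, -⟩, -⟩ : (Δ₁.Disjoint Δ₂ ∧ Δ₁.Disjoint Δ₃) ∧ Δ₂.Disjoint Δ₃ := by
    simpa using h.1
  exact h1

/-- A declaration can be replaced by another declaration of the same name. -/
theorem comma_single (h : Comma Δ [.single a A, Δ₂, Δ₃]) :
    Comma (.single a B ∪ Δ₂) [.single a B, Δ₂] :=
  comma₂ fun c hc => h.disj₁₂ c (Ctx.mem_single.2 (Ctx.mem_single.1 hc))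

end Comma

theorem Proc.fresh {Ψ : FCtx} {Δ : SCtx} {c : Name} {C : CTy} : Proc Ψ Δ c C → c ∉ Δ
  | .fwd a b A h => fun hb => h (Ctx.mem_single.1 hb)
  | .cut _ _ _ hc _ _ => hc
  | .close _ => Finmap.notMem_empty
  | .wait _ _ hc _ => hc
  | .dshiftR P => P.fresh
  | .dshiftL _ _ h h' P => by simpa [h.mem₂, h'.mem₂, Ctx.mem_single] using P.fresh
  | .ushiftR P => P.fresh
  | .ushiftL _ _ h h' P => by simpa [h.mem₂, h'.mem₂, Ctx.mem_single] using P.fresh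
  | .plusR _ P => P.fresh
  | .plusL _ _ _ _ hc _ => hc
  | .ampR ha _ => ha
  | .ampL _ _ _ h h' P => by simpa [h.mem₂, h'.mem₂, Ctx.mem_single] using P.fresh
  | .tensorR _ _ _ ha _ => ha
  | .tensorL _ _ _ _ h h' P => by
    have := P.fresh
    simp only [h.mem₃, Ctx.mem_single] at this
    simp only [h'.mem₂, Ctx.mem_single]
    tauto
  | .lollyR _ _ h P => fun ha => P.fresh (h.mem₂.2 (Or.inl ha))
  | .lollyL _ _ _ _ _ _ hc _ => hc
  | .andR _ P => P.fresh
  | .andL _ _ _ _ _ h h' P => by simpa [h.mem₂, h'.mem₂, Ctx.mem_single] using P.fresh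
  | .impR _ _ _ P => P.fresh
  | .impL _ _ _ h h' _ P => by simpa [h.mem₂, h'.mem₂, Ctx.mem_single] using P.fresh
  | .muR P => P.fresh
  | .muL _ _ h h' P => by simpa [h.mem₂, h'.mem₂, Ctx.mem_single] using P.fresh
  | .exec _ _ _ hb _ => hb

theorem Proc.notMem_union {Ψ : FCtx} {Δ₁ Δ₂ Γ : SCtx} {a b : Name} {A A' B : CTy}
    (P : Proc Ψ Δ₁ a A) (hΓ : Comma Γ [.single a A', Δ₂, .single b B]) :
    a ∉ (Δ₁ ∪ .single b B : SCtx) := by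
  have h : a ≠ b := fun h =>
    hΓ.rotate.rotate.disj₁₂ a (Ctx.mem_single.2 h) (Ctx.mem_single.2 rfl)
  intro h'
  rcases Finmap.mem_union.1 h' with h' | h'
  · exact P.fresh h'
  · exact h (Ctx.mem_single.1 h')

end SILL

open SILL

namespace SILL

/-! ## Least fixed points -/

section Lfp
variable {D : Dom}

-- Both cuts are traces, so each is governed by the least solution of feedback equations on the
-- shared channel; the proof compares the two systems. Fix the environment `u`, the input `x` on `Δ`
-- and the input `k` on the provided channel.
--
-- For the cut over `a : A` the unknowns are `n` (negative) and `p` (positive): `n` is what `Q` puts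
-- out on `a` when it is given `p` there, and `p` is what `P` provides when it is given `n`. For the
-- cut over `a : B ⊗ A` the unknowns are a pair `(m, n')` and an element `l` of a lifted product.
-- Whatever it is given, the sender puts out `⌊(b⁺, p')⌋`, where `b⁺` is the component of `x` at `b`
-- and `p'` is what `P` provides on `n'`. This is never `⊥`, even if both components are, so at the
-- fixed point the receiver takes its second branch. It then runs `Q` with `p'` on `a` and `b⁺` on
-- `b`, as the first cut would. The equations that remain say that `n'` and `m` are the outputs of
-- `Q` on `a` and on `b`.
--
-- Hence `(n', p')` solves the first system. Conversely, a solution `(n, p)` of the first system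
-- extends to a solution of the second, `m` being the output of `Q` on `b`. Leastness on both sides
-- gives `n = n'`, so `P` and `Q` run on the same arguments in both cuts. The outputs agree as well.
-- The only channel that changes sides is `b`, used by the receiving half of the first cut and by
-- the sending half of the second; there the sender returns `m`, which is the output of `Q` on `b`.
--
-- `exists_cutSem_eq` turns a trace into a least solution, `tensorRSem_res` and `tensorLSem_upd`
-- evaluate the sender and the receiver at the cut, and `cutSem_tensor_eta` makes the comparison.
-- The bookkeeping of names is in `upd_get_upd_upd` and `join_upd_get_upd`.

theorem lfp_le (f : D ⟶c D) {x : D} (h : f x ≤ x) : lfp f ≤ x := by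
  refine (isLUB_lfp f).2 ?_
  rintro _ ⟨n, rfl⟩
  induction n with
  | zero => exact bot_le
  | succ n ih =>
    dsimp only at ih ⊢
    rw [Function.iterate_succ_apply']
    exact (f.mono ih).trans h

theorem monotone_iterate_bot (f : D ⟶c D) : Monotone fun n : ℕ => f^[n] ⊥ :=
  monotone_nat_of_le_succ fun n => by
    rw [Function.iterate_succ_apply]
    exact f.mono.iterate n bot_le

/-- Kleene's argument: by continuity `f` sends the supremum of the iterates to the supremum of the
shifted iterates, which are again iterates. This gives `f (lfp f) ≤ lfp f`; the converse comes from
leastness. -/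
theorem map_lfp (f : D ⟶c D) : f (lfp f) = lfp f := by
  have h : f (lfp f) ≤ lfp f := by
    refine (f.cont (Set.range_nonempty _) ?_ (isLUB_lfp f)).2 ?_
    · exact (monotone_iterate_bot f).directed_le.directedOn_range
    · rintro _ ⟨_, ⟨n, rfl⟩, rfl⟩
      exact (isLUB_lfp f).1 ⟨n + 1, Function.iterate_succ_apply' _ _ _⟩
  -- By monotonicity `f (lfp f)` is itself a prefixed point, so `lfp f` lies below it.
  exact h.antisymm (lfp_le f (f.mono h))

end Lfp

/-! ## Components of tuples -/

section Components
variable {q : Pol} {Γ Δ Δ₁ Δ₂ : SCtx} {a c : Name} {A C : CTy}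

/-- The component of a tuple at `c` lives in `declAsp q (Δ.lookup c)`, which equals `C.asp q` only
along a proof that `c : C` is declared. Every computation with components therefore meets such
transports, and composing them disposes of all of them. -/
theorem castDom_castDom {D E F : Dom} (h : D = E) (h' : E = F) (x : D) :
    castDom h' (castDom h x) = castDom (h.trans h') x := by
  subst h h'
  rfl

theorem castDom_injective {D E : Dom} (h : D = E) : Function.Injective (castDom h) := by
  subst h
  exact Function.injective_id

theorem get_of_lookup (h : Δ.lookup c = some C) (x : Δ.sem q) :
    get c C x = castDom (declAsp_of_eq h) (x c) := dif_pos h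

/-- Tuples are determined by their components at the declared names. -/
theorem SCtx.sem_ext {x y : Δ.sem q}
    (h : ∀ c C, Δ.lookup c = some C → get c C x = get c C y) : x = y := by
  refine funext fun c => ?_
  cases hc : Δ.lookup c with
  | none =>
    -- The lookup is generalized to a variable `o`, so that `none` can be substituted in the type of
    -- the components; at an undeclared name this type has a single point.
    have key : ∀ (o : Option CTy), o = none → ∀ s t : declAsp q o, s = t := by
      rintro _ rfl _ _
      rfl
    exact key _ hc _ _
  | some C =>
    have := h c C hc
    rw [get_of_lookup hc, get_of_lookup hc] at this
    exact castDom_injective _ this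

/-- The two lookup hypotheses select the first branch of `res`, so that its default value `⊥` is
never reached. They have the same role in the lemmas on `upd` and `join`. -/
theorem get_res (hΔ : Δ.lookup c = some C) (hΓ : Γ.lookup c = some C) (x : Δ.sem q) :
    get c C (res x : Γ.sem q) = get c C x := by
  rw [get_of_lookup hΔ, get_of_lookup hΓ, res, dif_pos (hΔ.trans hΓ.symm)]
  exact castDom_castDom _ _ _

theorem get_upd_self (h : Γ.lookup a = some A) (v : A.asp q) (x : Δ.sem q) :
    get a A (upd a A v x : Γ.sem q) = v := by
  rw [get_of_lookup h, upd, dif_pos ⟨rfl, h⟩]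
  -- The composite transport goes from a domain to itself, so it is the identity by definition.
  exact castDom_castDom _ _ _

/-- Away from `a`, an update is a restriction, so `get_res` applies. -/
theorem get_upd_of_ne (hca : c ≠ a) (hΔ : Δ.lookup c = some C) (hΓ : Γ.lookup c = some C)
    (v : A.asp q) (x : Δ.sem q) : get c C (upd a A v x : Γ.sem q) = get c C x := by
  rw [← get_res hΔ hΓ x, get_of_lookup hΓ, get_of_lookup hΓ, upd, dif_neg fun h => hca h.1]

/-- `join` prefers its first argument, so a name declared in `Δ₁` needs no disjointness here. This
bias is why `get_join_right` asks for `c ∉ Δ₁`. -/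
theorem get_join_left (hΔ : Δ₁.lookup c = some C) (hΓ : Γ.lookup c = some C)
    (x : Δ₁.sem q) (y : Δ₂.sem q) : get c C (join x y : Γ.sem q) = get c C x := by
  rw [← get_res hΔ hΓ x, get_of_lookup hΓ, get_of_lookup hΓ, join,
    if_pos (Finmap.mem_of_lookup_eq_some hΔ)]

theorem get_join_right (hc : c ∉ Δ₁) (hΔ : Δ₂.lookup c = some C) (hΓ : Γ.lookup c = some C)
    (x : Δ₁.sem q) (y : Δ₂.sem q) : get c C (join x y : Γ.sem q) = get c C y := by
  rw [← get_res hΔ hΓ y, get_of_lookup hΓ, get_of_lookup hΓ, join, if_neg hc]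

end Components

/-! ## Cuts -/

section Cut
variable {U : Dom} {Δ Γ₁ Γ₂ : SCtx} {C : CTy}

/-- The value of a cut is computed from the least solution `(n, p)` of the feedback equations on the
shared channel. -/
theorem exists_cutSem_eq (a : Name) (A : CTy) (P : U ⟶c Beh Γ₁ A) (Q : U ⟶c Beh Γ₂ C) (u : U)
    (x : Δ.sem .pos) (k : C.asp .neg) :
    ∃ (n : A.asp .neg) (p : A.asp .pos),
      get a A ((Q u).toFun (upd a A p x, k)).1 = n ∧
      ((P u).toFun (res x, n)).2 = p ∧
      (∀ n' p', get a A ((Q u).toFun (upd a A p' x, k)).1 ≤ n' →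
        ((P u).toFun (res x, n')).2 ≤ p' → n ≤ n' ∧ p ≤ p') ∧
      (cutSem (Δ := Δ) a A P Q u).toFun (x, k) =
        (join ((P u).toFun (res x, n)).1 ((Q u).toFun (upd a A p x, k)).1,
          ((Q u).toFun (upd a A p x, k)).2) := by
  -- The feedback part of the cut with the external input `(x, k)` held fixed: the map whose least
  -- fixed point the trace inserts.
  have hc : ScottContinuous fun w : (A.asp .neg).prod (A.asp .pos) =>
      (cutBody (Δ := Δ) a A P Q u ((x, k), w)).2 := by
    unfold cutBody
    fun_prop
  let f : (A.asp .neg).prod (A.asp .pos) ⟶c (A.asp .neg).prod (A.asp .pos) := ⟨_, hc⟩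
  have h := map_lfp f
  -- The two equations are the components of `f (lfp f) = lfp f`. The formula for the value holds by
  -- definition, because the trace evaluates the body at this same `lfp f`.
  refine ⟨(lfp f).1, (lfp f).2, congrArg Prod.fst h, congrArg Prod.snd h, fun n' p' h1 h2 => ?_, rfl⟩
  -- Leastness is among all prefixed points, so it applies to pairs that satisfy only inequalities;
  -- the order on the product is componentwise.
  exact lfp_le f (x := (n', p')) ⟨h1, h2⟩

end Cut

/-! ## Lookup in composed contexts -/

section Lookup
variable {T : Type} {Δ Δ₁ Δ₂ Δ₃ : Ctx T} {a c : Name} {A C : T}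

theorem Ctx.lookup_single_self : (Ctx.single a A).lookup a = some A :=
  Finmap.lookup_singleton_eq

/-- The union of contexts prefers its first member. All other positions reduce to this one by
exchange, and exchange is where disjointness enters. -/
theorem Comma.lookup₂_left (h : Comma Δ [Δ₁, Δ₂]) (hc : Δ₁.lookup c = some C) :
    Δ.lookup c = some C := by
  obtain ⟨-, rfl⟩ := h
  exact (Finmap.lookup_union_left (Finmap.mem_of_lookup_eq_some hc)).trans hc

theorem Comma.lookup₂_right (h : Comma Δ [Δ₁, Δ₂]) (hc : Δ₂.lookup c = some C) :
    Δ.lookup c = some C := h.symm.lookup₂_left hc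

theorem Comma.lookup₁ (h : Comma Δ [Δ₁, Δ₂, Δ₃]) (hc : Δ₁.lookup c = some C) :
    Δ.lookup c = some C := h.assoc.lookup₂_left hc

theorem Comma.lookup₂ (h : Comma Δ [Δ₁, Δ₂, Δ₃]) (hc : Δ₂.lookup c = some C) :
    Δ.lookup c = some C := h.rotate.lookup₁ hc

theorem Comma.lookup₃ (h : Comma Δ [Δ₁, Δ₂, Δ₃]) (hc : Δ₃.lookup c = some C) :
    Δ.lookup c = some C := h.rotate.rotate.lookup₁ hc

/-- Some member declares `c`, a priori with a type `D`. That declaration is inherited by `Δ`, and a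
context assigns only one type to a name, so `D` is `C`. -/
theorem Comma.cases₃ (h : Comma Δ [Δ₁, Δ₂, Δ₃]) (hc : Δ.lookup c = some C) :
    Δ₁.lookup c = some C ∨ Δ₂.lookup c = some C ∨ Δ₃.lookup c = some C := by
  rcases h.mem₃.1 (Finmap.mem_of_lookup_eq_some hc) with h' | h' | h' <;>
    obtain ⟨D, hD⟩ := Finmap.mem_iff.1 h'
  · exact Or.inl (hD.trans ((h.lookup₁ hD).symm.trans hc))
  · exact Or.inr (Or.inl (hD.trans ((h.lookup₂ hD).symm.trans hc)))
  · exact Or.inr (Or.inr (hD.trans ((h.lookup₃ hD).symm.trans hc)))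

theorem Ctx.of_lookup_single (h : (Ctx.single a A).lookup c = some C) : c = a ∧ C = A := by
  obtain rfl := Ctx.mem_single.1 (Finmap.mem_of_lookup_eq_some h)
  exact ⟨rfl, Option.some.inj (h.symm.trans Ctx.lookup_single_self)⟩

end Lookup

/-! ## The `η` law for `⊗` -/

section TensorEta
variable {Δ₁ Δ₂ Γ Δ : SCtx} {a b : Name} {A B T C : CTy} {q : Pol}

/-- The input of the continuation of a reception, if `b` itself was sent on `a`. -/
theorem upd_get_upd_upd
    (hΓ : Comma Γ [Ctx.single a A, Δ₂, Ctx.single b B])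
    (hΔ : Comma Δ [Δ₁, Δ₂, Ctx.single b B]) (v : A.asp q) (w : T.asp q) (x : Δ.sem q) :
    (upd b B (get b B x)
      (upd a A v (upd a T w x : (Ctx.single a T ∪ Δ₂ : SCtx).sem q) : Γ.sem q) : Γ.sem q) =
      upd a A v x := by
  have hb : Γ.lookup b = some B := hΓ.lookup₃ Ctx.lookup_single_self
  have ha : Γ.lookup a = some A := hΓ.lookup₁ Ctx.lookup_single_self
  have hab : a ≠ b := fun h =>
    hΓ.rotate.rotate.disj₁₂ a (Ctx.mem_single.2 h) (Ctx.mem_single.2 rfl)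
  refine SCtx.sem_ext fun c C hc => ?_
  rcases hΓ.cases₃ hc with h | h | h
  · obtain ⟨rfl, rfl⟩ := Ctx.of_lookup_single h
    rw [get_upd_of_ne hab ha ha, get_upd_self ha, get_upd_self ha]
  · have hm := Finmap.mem_of_lookup_eq_some h
    have hca : c ≠ a := fun e => hΓ.disj₁₂ c (Ctx.mem_single.2 e) hm
    have hcb : c ≠ b := fun e => hΓ.rotate.disj₁₂ c hm (Ctx.mem_single.2 e)
    have hc' : (Ctx.single a T ∪ Δ₂ : SCtx).lookup c = some C :=
      (comma_single hΓ).lookup₂_right h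
    -- A name of `Δ₂` is declared in every context on the way, including the intermediate `a : T,
    -- Δ₂`, and differs from `a` and `b`; its value passes through all the updates.
    rw [get_upd_of_ne hcb hc hc, get_upd_of_ne hca hc' hc, get_upd_of_ne hca (hΔ.lookup₂ h) hc',
      get_upd_of_ne hca (hΔ.lookup₂ h) hc]
  · obtain ⟨rfl, rfl⟩ := Ctx.of_lookup_single h
    -- The intermediate context `a : T, Δ₂` does not declare `b`, so the value there is lost; the
    -- outer update puts it back.
    rw [get_upd_self hb, get_upd_of_ne hab.symm (hΔ.lookup₃ h) hb]

/-- The output of the sender and the receiver, if the output on `b` is the one received on `a`. -/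
theorem join_upd_get_upd
    (hΓ : Comma Γ [Ctx.single a A, Δ₂, Ctx.single b B])
    (hΔ : Comma Δ [Δ₁, Δ₂, Ctx.single b B]) (w : T.asp q) (y : Δ₁.sem q) (z : Γ.sem q) :
    (join (upd b B (get b B z) y : (Δ₁ ∪ Ctx.single b B : SCtx).sem q)
      (upd a T w z : (Ctx.single a T ∪ Δ₂ : SCtx).sem q) : Δ.sem q) = join y z := by
  have hΘ : Comma (Δ₁ ∪ Ctx.single b B) [Δ₁, Ctx.single b B] :=
    comma₂ hΔ.rotate.rotate.disj₁₂.symm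
  refine SCtx.sem_ext fun c C hc => ?_
  rcases hΔ.cases₃ hc with h | h | h
  · have hcb : c ≠ b := fun e =>
      hΔ.rotate.rotate.disj₁₂ c (Ctx.mem_single.2 e) (Finmap.mem_of_lookup_eq_some h)
    have hc' := hΘ.lookup₂_left h
    rw [get_join_left hc' hc, get_join_left h hc, get_upd_of_ne hcb h hc']
  · have hm := Finmap.mem_of_lookup_eq_some h
    have hca : c ≠ a := fun e => hΓ.disj₁₂ c (Ctx.mem_single.2 e) hm
    have h1 : c ∉ Δ₁ := fun e => hΔ.disj₁₂ c e hm
    have hc' : (Ctx.single a T ∪ Δ₂ : SCtx).lookup c = some C :=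
      (comma_single hΓ).lookup₂_right h
    have h2 : c ∉ (Δ₁ ∪ Ctx.single b B : SCtx) := fun e =>
      (hΘ.mem₂.1 e).elim h1 fun e => hΔ.rotate.disj₁₂ c hm e
    -- A name of `Δ₂` is on the receiving side in both cuts, and the value `w` written at `a` does
    -- not touch it.
    rw [get_join_right h2 hc' hc, get_join_right h1 (hΓ.lookup₂ h) hc,
      get_upd_of_ne hca (hΓ.lookup₂ h) hc']
  · have h1 : c ∉ Δ₁ := fun e =>
      hΔ.rotate.rotate.disj₁₂ c (Finmap.mem_of_lookup_eq_some h) e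
    obtain ⟨rfl, rfl⟩ := Ctx.of_lookup_single h
    have hc' := hΘ.lookup₂_right h
    -- Here `b` changes sides: the left tuple supplies it on one side of the equation and the right
    -- tuple on the other. They agree because the value written is the component of `z` at `b`.
    rw [get_join_left hc' hc, get_upd_self hc', get_join_right h1 (hΓ.lookup₃ h) hc]

/-- Restriction along `Δ₁ ⊆ Δ₁, b : B ⊆ Δ`. -/
theorem res_res_union_single (hΔ : Comma Δ [Δ₁, Δ₂, Ctx.single b B]) (x : Δ.sem q) :
    (res (res x : (Δ₁ ∪ Ctx.single b B : SCtx).sem q) : Δ₁.sem q) = res x := by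
  have hΘ : Comma (Δ₁ ∪ Ctx.single b B) [Δ₁, Ctx.single b B] :=
    comma₂ hΔ.rotate.rotate.disj₁₂.symm
  refine SCtx.sem_ext fun c C hc => ?_
  rw [get_res (hΘ.lookup₂_left hc) hc, get_res (hΔ.lookup₁ hc) (hΘ.lookup₂_left hc),
    get_res (hΔ.lookup₁ hc) hc]

end TensorEta

-- Sender and receiver at the cut, and comparison of the two traces

section TensorEtaSem
variable {U : Dom} {Δ₁ Δ₂ Γ Δ : SCtx} {a b : Name} {A B : STy [] .pos} {C : CTy}

/-- Elements of the negative aspect of `B ⊗ A`. -/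
noncomputable def tensorNeg (m : CTy.asp ⟨_, B⟩ .neg) (n : CTy.asp ⟨_, A⟩ .neg) :
    CTy.asp ⟨_, .tensor B A⟩ .neg :=
  show (B.asp .neg).prod (A.asp .neg) from (m, n)

/-- Elements other than `⊥` of the positive aspect of `B ⊗ A`. -/
noncomputable def tensorPos (m : CTy.asp ⟨_, B⟩ .pos) (p : CTy.asp ⟨_, A⟩ .pos) :
    CTy.asp ⟨_, .tensor B A⟩ .pos :=
  up ((B.asp .pos).prod (A.asp .pos)) (m, p)

/-- The negative aspect of `B ⊗ A` is a product without lifting, so every element, `⊥` included, is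
a pair and no case distinction arises in this direction of the channel. -/
theorem exists_eq_tensorNeg (w : CTy.asp ⟨_, .tensor B A⟩ .neg) :
    ∃ (m : CTy.asp ⟨_, B⟩ .neg) (n : CTy.asp ⟨_, A⟩ .neg), w = tensorNeg m n :=
  ⟨Prod.fst (show (B.asp .neg).prod (A.asp .neg) from w),
    Prod.snd (show (B.asp .neg).prod (A.asp .neg) from w), rfl⟩

theorem tensorNeg_inj {m m' : CTy.asp ⟨_, B⟩ .neg} {n n' : CTy.asp ⟨_, A⟩ .neg}
    (h : (tensorNeg m n : CTy.asp ⟨_, .tensor B A⟩ .neg) = tensorNeg m' n') :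
    m = m' ∧ n = n' :=
  Prod.mk.inj h

/-- The product order is componentwise. Only the component of `A` is extracted, as this is the one
that is fed to `P`. -/
theorem snd_le_of_tensorNeg_le {m m' : CTy.asp ⟨_, B⟩ .neg} {n n' : CTy.asp ⟨_, A⟩ .neg}
    (h : (tensorNeg m n : CTy.asp ⟨_, .tensor B A⟩ .neg) ≤ tensorNeg m' n') : n ≤ n' :=
  And.right h

/-- The output of the sender. -/
theorem tensorRSem_res (hΔ : Comma Δ [Δ₁, Δ₂, Ctx.single b ⟨_, B⟩])
    (P : U ⟶c Beh Δ₁ ⟨_, A⟩) (u : U) (x : Δ.sem .pos) (m : CTy.asp ⟨_, B⟩ .neg)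
    (n : CTy.asp ⟨_, A⟩ .neg) :
    (tensorRSem (Δ := Δ₁ ∪ Ctx.single b ⟨_, B⟩) b B A P u).toFun (res x, tensorNeg m n) =
      (upd b ⟨_, B⟩ m ((P u).toFun (res x, n)).1,
        tensorPos (get b ⟨_, B⟩ x) ((P u).toFun (res x, n)).2) := by
  have hb : (Δ₁ ∪ Ctx.single b ⟨_, B⟩ : SCtx).lookup b = some ⟨_, B⟩ :=
    (comma₂ hΔ.rotate.rotate.disj₁₂.symm).lookup₂_right Ctx.lookup_single_self
  -- The right-hand side reads `x` directly, whereas the clause of the sender reads its restriction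
  -- to `Δ₁, b : B`. After both reads are routed through that restriction, the two sides agree by
  -- definition.
  rw [← res_res_union_single hΔ, ← get_res (hΔ.lookup₃ Ctx.lookup_single_self) hb x]
  rfl

/-- The output of the receiver, if `b` itself was sent on `a`. -/
theorem tensorLSem_upd (hΓ : Comma Γ [Ctx.single a ⟨_, A⟩, Δ₂, Ctx.single b ⟨_, B⟩])
    (hΔ : Comma Δ [Δ₁, Δ₂, Ctx.single b ⟨_, B⟩]) (Q : U ⟶c Beh Γ C) (u : U) (x : Δ.sem .pos)
    (p : CTy.asp ⟨_, A⟩ .pos) (k : C.asp .neg) :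
    (tensorLSem (Δ := Ctx.single a ⟨_, .tensor B A⟩ ∪ Δ₂) a b B A Q u).toFun
      (upd a ⟨_, .tensor B A⟩ (tensorPos (get b ⟨_, B⟩ x) p) x, k) =
      (upd a ⟨_, .tensor B A⟩
        (tensorNeg (get b ⟨_, B⟩ ((Q u).toFun (upd a ⟨_, A⟩ p x, k)).1)
          (get a ⟨_, A⟩ ((Q u).toFun (upd a ⟨_, A⟩ p x, k)).1))
        ((Q u).toFun (upd a ⟨_, A⟩ p x, k)).1, ((Q u).toFun (upd a ⟨_, A⟩ p x, k)).2) := by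
  have ha : (Ctx.single a (⟨_, .tensor B A⟩ : CTy) ∪ Δ₂ : SCtx).lookup a =
      some ⟨_, .tensor B A⟩ := (comma_single hΓ).lookup₂_left Ctx.lookup_single_self
  -- This writes the input of `Q` in the form produced by the clause of the receiver: `b` and `a`
  -- are set to the two received components.
  rw [← upd_get_upd_upd (T := ⟨_, .tensor B A⟩) hΓ hΔ p (tensorPos (get b ⟨_, B⟩ x) p) x]
  change onUp _ _ _ (get a ⟨_, .tensor B A⟩ (upd a ⟨_, .tensor B A⟩ _ x)) = _
  -- The value found on `a` is now visibly `tensorPos`, an element in the image of `up`, so `onUp`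
  -- reduces to its second branch.
  rw [get_upd_self ha]
  rfl

/-- Sending `b` on `a` to a process that receives it as `b` has no effect. -/
theorem cutSem_tensor_eta (hΓ : Comma Γ [Ctx.single a ⟨_, A⟩, Δ₂, Ctx.single b ⟨_, B⟩])
    (hΔ : Comma Δ [Δ₁, Δ₂, Ctx.single b ⟨_, B⟩]) (P : U ⟶c Beh Δ₁ ⟨_, A⟩) (Q : U ⟶c Beh Γ C) :
    (cutSem a ⟨_, A⟩ P Q : U ⟶c Beh Δ C) =
      cutSem a ⟨_, .tensor B A⟩ (tensorRSem (Δ := Δ₁ ∪ Ctx.single b ⟨_, B⟩) b B A P)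
        (tensorLSem (Δ := Ctx.single a ⟨_, .tensor B A⟩ ∪ Δ₂) a b B A Q) := by
  refine Hom.ext fun u => Hom.ext fun x => ?_
  obtain ⟨x, k⟩ := x
  have ha : (Ctx.single a (⟨_, .tensor B A⟩ : CTy) ∪ Δ₂ : SCtx).lookup a =
      some ⟨_, .tensor B A⟩ := (comma_single hΓ).lookup₂_left Ctx.lookup_single_self
  obtain ⟨n, p, hn, hp, hmin, h⟩ := exists_cutSem_eq (Δ := Δ) a ⟨_, A⟩ P Q u x k
  obtain ⟨w, l, hw, hl, hmin', h'⟩ := exists_cutSem_eq (Δ := Δ) a ⟨_, .tensor B A⟩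
    (tensorRSem (Δ := Δ₁ ∪ Ctx.single b ⟨_, B⟩) b B A P)
    (tensorLSem (Δ := Ctx.single a ⟨_, .tensor B A⟩ ∪ Δ₂) a b B A Q) u x k
  obtain ⟨m, n', rfl⟩ := exists_eq_tensorNeg w
  rw [tensorRSem_res hΔ] at hl h'
  -- The positive value on `a` becomes an explicit `tensorPos`, which is what `tensorLSem_upd`
  -- needs: this is where the case `⊥` of the receiver is ruled out.
  subst hl
  rw [tensorLSem_upd hΓ hΔ] at hw h'
  rw [get_upd_self ha] at hw
  obtain ⟨hm, hn'⟩ := tensorNeg_inj hw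
  -- The value `n'`, together with what `P` provides on it, solves the equations of the cut over
  -- `A`.
  have h1 : n ≤ n' := (hmin n' _ hn'.le le_rfl).1
  -- A solution for the cut over `B ⊗ A` is built from `(n, p)`: the component of `B` is the output
  -- of `Q` on `b`, and the positive value is `p` paired with the input on `b`.
  have h2 : n' ≤ n := snd_le_of_tensorNeg_le (hmin'
    (tensorNeg (get b ⟨_, B⟩ ((Q u).toFun (upd a ⟨_, A⟩ p x, k)).1) n)
    (tensorPos (get b ⟨_, B⟩ x) p)
    (by rw [tensorLSem_upd hΓ hΔ, get_upd_self ha, hn])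
    (by rw [tensorRSem_res hΔ, hp])).1
  obtain rfl : n = n' := h1.antisymm h2
  -- With the negative values identified, the positive ones agree too, each being the output of `P`
  -- on `n`.
  rw [hp] at hm h'
  refine h.trans (Eq.trans ?_ h'.symm)
  -- By `hm` the value that the sender returns on `b` is the output of `Q` on `b`, which is the form
  -- `join_upd_get_upd` requires.
  rw [← hm, join_upd_get_upd hΓ hΔ]

end TensorEtaSem

end SILL

/-- The denotation of a derivation unfolds to the semantic clauses of its rules, so this is
`cutSem_tensor_eta` for the denotations of `P` and `Q`. -/
theorem mainTheorem4 {Ψ : FCtx} {Δ₁ Δ₂ Γ Δ : SCtx} {a b c : Name} {A B : STy [] Pol.pos} {C : CTy}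
    (hΓ : Comma Γ [Ctx.single a ⟨_, A⟩, Δ₂, Ctx.single b ⟨_, B⟩])
    (hΔ : Comma Δ [Δ₁, Δ₂, Ctx.single b ⟨_, B⟩]) (hc : c ∉ Δ)
    (P : Proc Ψ Δ₁ a ⟨_, A⟩) (Q : Proc Ψ Γ c C) :
    Proc.Equiv
      (Proc.cut a hΓ.assoc hΔ.assoc hc P Q)
      (Proc.cut a (comma_single hΓ) hΔ.rotate.rotate.swap.assoc' hc
        (Proc.tensorR b B (comma₂ hΔ.rotate.rotate.disj₁₂.symm) (P.notMem_union hΓ) P)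
        (Proc.tensorL a b B A hΓ.swap (comma_single hΓ).symm Q)) :=
  cutSem_tensor_eta hΓ hΔ P.sem Q.sem
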